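/- **Conventions.** Let $\mathfrak L=\bigoplus_{k\le 0}\mathfrak L_k$ be a real $L_\infty$-algebra concentrated in non-positive degrees with finite-dimensional homogeneous components, with brackets $\mu_k$ of degree $2-k$, and let $(e_\alpha)$ be a homogeneous basis. Let $t^\alpha\in\mathfrak L[1]^*$ be the shifted dual generators, $|t^\alpha|=1-|e_\alpha|\ge 1$. The Chevalley–Eilenberg algebra $\mathsf{CE}(\mathfrak L)=(\odot^\bullet\mathfrak L[1]^*,\mathsf d_{\mathsf{CE}})$ is the free graded-commutative algebra on the $t^\alpha$ with $$\mathsf d_{\mathsf{CE}}t^\alpha=-\sum_{k\ge1}\tfrac1{k!}\sum_{\beta_1,\dots,\beta_k}(-1)^{k\sum_i|t^{\beta_i}|+\sum_{i<j}|t^{\beta_j}||e_{\beta_i}|}\,\mu^\alpha_{\beta_1\dots\beta_k}\,t^{\beta_1}\cdots t^{\beta_k},\qquad \mu_k(e_{\beta_1},\dots,e_{\beta_k})=\mu^\alpha_{\beta_1\dots\beta_k}e_\alpha .$$ The Weil algebra $\mathsf W(\mathfrak L)=(\odot^\bullet(\mathfrak L[1]^*\oplus\mathfrak L[2]^*),\mathsf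 d_{\mathsf W})$ is the free graded-commutative algebra on the $t^\alpha$ and on $\sigma(t^\alpha)$ of degree $|t^\alpha|+1$. Here $\sigma$ is extended to a derivation of degree $1$ with $\sigma^2=0$, and $\mathsf d_{\mathsf W}$ is the derivation with $\mathsf d_{\mathsf W}t=\mathsf d_{\mathsf{CE}}t+\sigma(t)$ and $\mathsf d_{\mathsf W}\sigma(t)=-\sigma(\mathsf d_{\mathsf W}t)$. Let $\mathsf W(\mathfrak L)\to\mathsf{CE}(\mathfrak L)$ be the projection $t\mapsto t$, $\sigma(t)\mapsto0$. An automorphism $\phi$ of the graded algebra $\mathsf W(\mathfrak L)$ (not required to commute with $\mathsf d_{\mathsf W}$) covers the identity if its composition with this projection is again this projection. **Truncated BRST complex.** Let $U\subseteq\mathbb R^n$ be a contractible open set and $G$ a free graded-commutative real algebra on ghost parameters of positive ghost degrees; signs in $\Omega^\bullet(U)\otimes G$ are governed by the total degree, form degree plus ghost degree. A connection with ghosts is a morphism of graded algebras $\mathcal A:\mathsf W(\mathfrak L)\to\Omega^\bullet(U)\otimes G$ (preserving the total degree) such that the part of ghost degree $0$ of $(\mathrm d_U\circ\mathcal A-\mathcal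 A\circ\mathsf d_{\mathsf W})(t^\alpha)$ vanishes for all $\alpha$, i.e. the ghost-degree-$0$ part of $\mathcal A(\sigma(t^\alpha))$ is the curvature of the gauge potentials. The curvature ghost $d^\alpha_j$, $j\ge1$, is the part of ghost degree $j$ of $\mathcal A(\phi(\sigma(t^\alpha)))$, and $Q_{\rm BRST}d^\alpha_j$ is the part of ghost degree $j+1$ of $(\mathrm d_U\circ\mathcal A-\mathcal A\circ\mathsf d_{\mathsf W})(\phi(\sigma(t^\alpha)))$. The truncated BRST complex closes if for all $n$, all such $U\subseteq\mathbb R^n$ and $G$, and all connections with ghosts $\mathcal A$ with $d^\alpha_j=0$ for all $\alpha$ and all $j\ge1$, one has $Q_{\rm BRST}d^\alpha_j=0$ for all $\alpha$ and all $j\ge1$. An automorphism $\phi$ of the graded algebra $\mathsf W(\mathfrak L)$ covering the identity is called an *adjustment* if the truncated BRST complex closes. **Proposition.** Let $\mathfrak L$ be as above and let $\phi$ be an automorphism of the graded algebra $\mathsf W(\mathfrak L)$ covering the identity of $\mathsf{CE}(\mathfrak L)$. Then $\phi$ is an adjustment if and only if for every generator $t=t^\alpha$ there are real structure constants $m_{\alpha_1\dots\alpha_i}$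 and $n_{\alpha_0\alpha_1\dots\alpha_i}$ (only finitely many of them non-zero, for the given $\alpha$) with $n_{\alpha_0\alpha_1\dots\alpha_i}=0$ unless $|t^{\alpha_0}|=1$, such that $$\mathsf d_{\mathsf W}(\phi(\sigma(t)))=\sum_i\frac1{i!}\Big(m_{\alpha_1\dots\alpha_i}\,\phi(\sigma(t^{\alpha_1}))\cdots\phi(\sigma(t^{\alpha_i}))+n_{\alpha_0\alpha_1\dots\alpha_i}\,t^{\alpha_0}\,\phi(\sigma(t^{\alpha_1}))\cdots\phi(\sigma(t^{\alpha_i}))\Big),$$ with repeated indices summed over. -/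

import Mathlib

open scoped TensorProduct ContDiff

noncomputable section

namespace HigherGauge

/-! ## Free graded-commutative algebras over `ℝ` -/

/-- The graded-commutativity relations between generators `x` of degree `deg x`. -/
inductive GCRel {ι : Type*} (deg : ι → ℕ) : FreeAlgebra ℝ ι → FreeAlgebra ℝ ι → Prop
  | comm (x y : ι) : GCRel deg (FreeAlgebra.ι ℝ x * FreeAlgebra.ι ℝ y)
      ((-1 : ℝ) ^ (deg x * deg y) • (FreeAlgebra.ι ℝ y * FreeAlgebra.ι ℝ x))

/-- The free graded-commutative real algebra on generators `x : ι` of degree `deg x`, i.e. the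
graded symmetric algebra of the graded vector space with homogeneous basis `ι`
(squares of odd generators vanish because `2` is invertible). -/
def FreeGC {ι : Type*} (deg : ι → ℕ) : Type _ := RingQuot (GCRel deg)

namespace FreeGC

instance {ι : Type*} (deg : ι → ℕ) : Ring (FreeGC deg) :=
  inferInstanceAs (Ring (RingQuot (GCRel deg)))

instance {ι : Type*} (deg : ι → ℕ) : Algebra ℝ (FreeGC deg) :=
  inferInstanceAs (Algebra ℝ (RingQuot (GCRel deg)))

/-- The generator with label `x`. -/
def gen {ι : Type*} (deg : ι → ℕ) (x : ι) : FreeGC deg :=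
  RingQuot.mkAlgHom ℝ (GCRel deg) (FreeAlgebra.ι ℝ x)

theorem gen_mul_gen {ι : Type*} (deg : ι → ℕ) (x y : ι) :
    gen deg x * gen deg y = (-1 : ℝ) ^ (deg x * deg y) • (gen deg y * gen deg x) := by
  have h := RingQuot.mkAlgHom_rel ℝ (GCRel.comm (deg := deg) x y)
  rw [map_mul, map_smul, map_mul] at h
  exact h

/-- The universal property. -/
def lift {ι : Type*} {deg : ι → ℕ} {A : Type*} [Ring A] [Algebra ℝ A] (f : ι → A)
    (hf : ∀ x y, f x * f y = (-1 : ℝ) ^ (deg x * deg y) • (f y * f x)) : FreeGC deg →ₐ[ℝ] A :=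
  RingQuot.liftAlgHom ℝ (s := GCRel deg) ⟨FreeAlgebra.lift ℝ f, by
    intro a b h
    cases h with
    | comm x y => simpa using hf x y⟩

theorem lift_gen {ι : Type*} {deg : ι → ℕ} {A : Type*} [Ring A] [Algebra ℝ A] (f : ι → A)
    (hf : ∀ x y, f x * f y = (-1 : ℝ) ^ (deg x * deg y) • (f y * f x)) (x : ι) :
    lift f hf (gen deg x) = f x := by
  have h := RingQuot.liftAlgHom_mkAlgHom_apply ℝ (FreeAlgebra.lift ℝ f) (s := GCRel deg) (by
    intro a b h
    cases h with
    | comm x y => simpa using hf x y) (FreeAlgebra.ι ℝ x)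
  rw [FreeAlgebra.lift_ι_apply] at h
  exact h

/-- The homogeneous elements of degree `n`: the span of the words of total degree `n`. -/
def homog {ι : Type*} (deg : ι → ℕ) (n : ℕ) : Submodule ℝ (FreeGC deg) :=
  Submodule.span ℝ {a | ∃ l : List ι, (l.map deg).sum = n ∧ a = (l.map (gen deg)).prod}

theorem word_mem {ι : Type*} {deg : ι → ℕ} {n : ℕ} (l : List ι) (h : (l.map deg).sum = n) :
    (l.map (gen deg)).prod ∈ homog deg n := Submodule.subset_span ⟨l, h, rfl⟩

theorem gen_mem {ι : Type*} (deg : ι → ℕ) (x : ι) : gen deg x ∈ homog deg (deg x) := by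
  simpa using word_mem (deg := deg) [x] rfl

theorem mul_mem {ι : Type*} {deg : ι → ℕ} {m n : ℕ} {a b : FreeGC deg}
    (ha : a ∈ homog deg m) (hb : b ∈ homog deg n) : a * b ∈ homog deg (m + n) := by
  induction ha using Submodule.span_induction with
  | zero => simp
  | add x y _ _ hx hy => rw [add_mul]; exact add_mem hx hy
  | smul c x _ hx => rw [smul_mul_assoc]; exact Submodule.smul_mem _ _ hx
  | mem x hx =>
    obtain ⟨l, hl, rfl⟩ := hx
    induction hb using Submodule.span_induction with
    | zero => simp
    | add x y _ _ hx hy => rw [mul_add]; exact add_mem hx hy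
    | smul c x _ hx => rw [mul_smul_comm]; exact Submodule.smul_mem _ _ hx
    | mem y hy =>
      obtain ⟨l', hl', rfl⟩ := hy
      rw [← List.prod_append, ← List.map_append]
      exact word_mem _ (by simp [hl, hl'])

theorem gen_comm_word {ι : Type*} (deg : ι → ℕ) (x : ι) (l : List ι) :
    gen deg x * (l.map (gen deg)).prod
      = (-1 : ℝ) ^ (deg x * (l.map deg).sum) • ((l.map (gen deg)).prod * gen deg x) := by
  induction l with
  | nil => simp
  | cons y l ih =>
    simp only [List.map_cons, List.prod_cons, List.sum_cons]
    rw [← mul_assoc, gen_mul_gen, smul_mul_assoc, mul_assoc, ih, mul_smul_comm, smul_smul,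
      ← pow_add, ← mul_add, mul_assoc]

theorem word_comm_word {ι : Type*} (deg : ι → ℕ) (l l' : List ι) :
    (l.map (gen deg)).prod * (l'.map (gen deg)).prod
      = (-1 : ℝ) ^ ((l.map deg).sum * (l'.map deg).sum) •
        ((l'.map (gen deg)).prod * (l.map (gen deg)).prod) := by
  induction l with
  | nil => simp
  | cons x l ih =>
    simp only [List.map_cons, List.prod_cons, List.sum_cons]
    rw [mul_assoc, ih, mul_smul_comm, ← mul_assoc, gen_comm_word, smul_mul_assoc, smul_smul,
      mul_assoc, ← pow_add, add_mul, add_comm]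

/-- Graded commutativity of homogeneous elements. -/
theorem graded_comm {ι : Type*} {deg : ι → ℕ} {m n : ℕ} {a b : FreeGC deg}
    (ha : a ∈ homog deg m) (hb : b ∈ homog deg n) : a * b = (-1 : ℝ) ^ (m * n) • (b * a) := by
  induction ha using Submodule.span_induction with
  | zero => simp
  | add x y _ _ hx hy => rw [add_mul, mul_add, hx, hy, smul_add]
  | smul c x _ hx => rw [smul_mul_assoc, hx, mul_smul_comm, smul_comm]
  | mem x hx =>
    obtain ⟨l, hl, rfl⟩ := hx
    induction hb using Submodule.span_induction with
    | zero => simp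
    | add x y _ _ hx hy => rw [mul_add, add_mul, hx, hy, smul_add]
    | smul c x _ hx => rw [smul_mul_assoc, mul_smul_comm, hx, smul_comm]
    | mem y hy =>
      obtain ⟨l', hl', rfl⟩ := hy
      rw [word_comm_word, hl, hl']

/-- The part of weight `k`, where the generator `x` has weight `w x` and weights add up in
products: substitute `x ↦ x X ^ (w x)` and take the coefficient of `X ^ k`. -/
def weightPart {ι : Type*} (deg : ι → ℕ) (w : ι → ℕ) (k : ℕ) : FreeGC deg →ₗ[ℝ] FreeGC deg where
  toFun a := (lift (deg := deg) (fun x => Polynomial.monomial (w x) (gen deg x)) (by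
    intro x y
    rw [Polynomial.monomial_mul_monomial, Polynomial.monomial_mul_monomial, gen_mul_gen,
      Polynomial.smul_monomial, add_comm]) a).coeff k
  map_add' a b := by simp
  map_smul' c a := by simp

/-- Graded derivations of degree `1` are freely determined by their values `D x` on generators,
`D x` being homogeneous of degree `deg x + 1`. This is the associated algebra map
`a ↦ !![(-1) ^ |a| a, D a; 0, a]`. -/
def derivHom {ι : Type*} {deg : ι → ℕ} (D : ι → FreeGC deg)
    (hD : ∀ x, D x ∈ homog deg (deg x + 1)) :
    FreeGC deg →ₐ[ℝ] Matrix (Fin 2) (Fin 2) (FreeGC deg) :=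
  lift (fun x => !![(-1 : ℝ) ^ deg x • gen deg x, D x; 0, gen deg x]) (by
    intro x y
    have h1 := gen_mul_gen deg x y
    have h2 := graded_comm (hD x) (gen_mem deg y)
    have h3 := graded_comm (gen_mem deg x) (hD y)
    have e : ∀ k : ℕ, ((-1 : ℝ) ^ k) * (-1) ^ k = 1 := fun k => by
      rw [← mul_pow]; norm_num
    ext i j
    fin_cases i <;> fin_cases j
    · simp [Matrix.mul_apply, h1, smul_smul]
      ring_nf
    · simp only [Matrix.mul_apply, Fin.sum_univ_two]
      simp [h2, h3, smul_smul, pow_add, mul_add, add_mul]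
      rw [add_comm]
      congr 2
      rw [← mul_assoc, mul_right_comm, e, one_mul]
    · simp [Matrix.mul_apply]
    · simp [Matrix.mul_apply, h1])

/-- The graded derivation of degree `1` with `x ↦ D x` on generators. -/
def deriv {ι : Type*} {deg : ι → ℕ} (D : ι → FreeGC deg)
    (hD : ∀ x, D x ∈ homog deg (deg x + 1)) : FreeGC deg →ₗ[ℝ] FreeGC deg where
  toFun a := derivHom D hD a 0 1
  map_add' a b := by simp
  map_smul' c a := by simp

theorem deriv_gen {ι : Type*} {deg : ι → ℕ} (D : ι → FreeGC deg)
    (hD : ∀ x, D x ∈ homog deg (deg x + 1)) (x : ι) : deriv D hD (gen deg x) = D x := by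
  simp [deriv, derivHom, lift_gen]

theorem derivHom_word {ι : Type*} {deg : ι → ℕ} (D : ι → FreeGC deg)
    (hD : ∀ x, D x ∈ homog deg (deg x + 1)) (l : List ι) :
    derivHom D hD (l.map (gen deg)).prod 0 0
        = (-1 : ℝ) ^ (l.map deg).sum • (l.map (gen deg)).prod ∧
      derivHom D hD (l.map (gen deg)).prod 1 0 = 0 ∧
      derivHom D hD (l.map (gen deg)).prod 1 1 = (l.map (gen deg)).prod := by
  induction l with
  | nil => simp
  | cons x l ih =>
    obtain ⟨h1, h2, h3⟩ := ih
    have hx : derivHom D hD (gen deg x)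
        = !![(-1 : ℝ) ^ deg x • gen deg x, D x; 0, gen deg x] := lift_gen _ _ _
    simp only [List.map_cons, List.prod_cons, List.sum_cons, map_mul, hx, Matrix.mul_apply,
      Fin.sum_univ_two]
    simp [h1, h2, h3, smul_smul, pow_add, mul_comm]

theorem derivHom_homog {ι : Type*} {deg : ι → ℕ} (D : ι → FreeGC deg)
    (hD : ∀ x, D x ∈ homog deg (deg x + 1)) {n : ℕ} {a : FreeGC deg} (ha : a ∈ homog deg n) :
    derivHom D hD a 0 0 = (-1 : ℝ) ^ n • a ∧ derivHom D hD a 1 0 = 0 ∧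
      derivHom D hD a 1 1 = a := by
  induction ha using Submodule.span_induction with
  | zero => simp
  | add x y _ _ hx hy => simp [hx.1, hx.2, hy.1, hy.2]
  | smul c x _ hx => simp [hx.1, hx.2, smul_comm c]
  | mem x hx =>
    obtain ⟨l, hl, rfl⟩ := hx
    rw [← hl]; exact derivHom_word D hD l

/-- The graded Leibniz rule. -/
theorem deriv_mul {ι : Type*} {deg : ι → ℕ} (D : ι → FreeGC deg)
    (hD : ∀ x, D x ∈ homog deg (deg x + 1)) {m n : ℕ} {a b : FreeGC deg}
    (ha : a ∈ homog deg m) (hb : b ∈ homog deg n) :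
    deriv D hD (a * b) = deriv D hD a * b + (-1 : ℝ) ^ m • (a * deriv D hD b) := by
  have h1 := derivHom_homog D hD ha
  have h2 := derivHom_homog D hD hb
  simp [deriv, Matrix.mul_apply, Fin.sum_univ_two, h1.1, h2.2.2, add_comm]

theorem deriv_mem {ι : Type*} {deg : ι → ℕ} (D : ι → FreeGC deg)
    (hD : ∀ x, D x ∈ homog deg (deg x + 1)) {n : ℕ} {a : FreeGC deg} (ha : a ∈ homog deg n) :
    deriv D hD a ∈ homog deg (n + 1) := by
  induction ha using Submodule.span_induction with
  | zero => simp
  | add x y _ _ hx hy => rw [map_add]; exact add_mem hx hy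
  | smul c x _ hx => rw [map_smul]; exact Submodule.smul_mem _ _ hx
  | mem x hx =>
    obtain ⟨l, hl, rfl⟩ := hx
    induction l generalizing n with
    | nil =>
      have : deriv D hD 1 = 0 := by simp [deriv]
      simp [this]
    | cons x l ih =>
      simp only [List.map_cons, List.prod_cons, List.sum_cons] at hl ⊢
      rw [deriv_mul D hD (gen_mem deg x) (word_mem l rfl), deriv_gen]
      subst hl
      refine add_mem ?_ (Submodule.smul_mem _ _ ?_)
      · have := mul_mem (hD x) (word_mem (deg := deg) l rfl)
        rwa [add_right_comm] at this
      · have := mul_mem (gen_mem deg x) (ih (n := (l.map deg).sum) rfl)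
        rwa [← add_assoc] at this

end FreeGC

/-! ## `L∞`-algebras -/

/-- The Koszul sign `χ(σ; ℓ₁, …, ℓₙ)` for homogeneous `ℓᵢ` of degree `d i`, arising when
`ℓ₁ ∧ … ∧ ℓₙ` is reordered to `ℓ_{σ 1} ∧ … ∧ ℓ_{σ n}`: every inversion contributes
`-(-1) ^ (|ℓ| |ℓ'|)`. -/
def koszulSign {n : ℕ} (d : Fin n → ℤ) (σ : Equiv.Perm (Fin n)) : ℝ :=
  ∏ q : Fin n × Fin n with q.1 < q.2 ∧ σ q.2 < σ q.1,
    -((Int.negOnePow (d (σ q.1) * d (σ q.2)) : ℤ) : ℝ)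

/-- `(j; n)`-unshuffles. -/
def IsUnshuffle {n : ℕ} (j : ℕ) (σ : Equiv.Perm (Fin n)) : Prop :=
  (∀ a b : Fin n, a < b → (b : ℕ) < j → σ a < σ b) ∧
    (∀ a b : Fin n, j ≤ (a : ℕ) → a < b → σ a < σ b)

open Classical in
/-- A real `L∞`-algebra with underlying graded vector space `V = ⨁ₖ gr k`: graded antisymmetric
brackets `μ k` of degree `2 - k` (with `k ≥ 1`; the formal `μ 0` is zero) which satisfy the
homotopy Jacobi identities. -/
structure LInfinityAlgebra (V : Type*) [AddCommGroup V] [Module ℝ V] where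
  /-- The homogeneous components. -/
  gr : ℤ → Submodule ℝ V
  isInternal : DirectSum.IsInternal gr
  /-- The higher brackets. -/
  μ : ∀ k : ℕ, MultilinearMap ℝ (fun _ : Fin k => V) V
  μ_zero : μ 0 = 0
  μ_mem : ∀ (k : ℕ) (d : Fin k → ℤ) (v : Fin k → V), (∀ i, v i ∈ gr (d i)) →
    μ k v ∈ gr (∑ i, d i + 2 - k)
  antisymm : ∀ (k : ℕ) (d : Fin k → ℤ) (v : Fin k → V), (∀ i, v i ∈ gr (d i)) →
    ∀ σ : Equiv.Perm (Fin k), μ k v = koszulSign d σ • μ k (fun i => v (σ i))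
  jacobi : ∀ (n : ℕ) (d : Fin n → ℤ) (v : Fin n → V), (∀ i, v i ∈ gr (d i)) →
    ∑ j : Fin (n + 1), ∑ σ : Equiv.Perm (Fin n) with IsUnshuffle j σ,
      (koszulSign d σ * (-1) ^ (n - (j : ℕ))) •
        μ (n - (j : ℕ) + 1) (Fin.cons
          (μ j (fun a : Fin j => v (σ ⟨a, by omega⟩)))
          (fun b : Fin (n - (j : ℕ)) => v (σ ⟨(j : ℕ) + b, by omega⟩))) = 0

/-- A homogeneous basis `(e α)` of an `L∞`-algebra which is concentrated in non-positive degrees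
and whose homogeneous components are finite-dimensional: `|e α| = - depth α` with
`depth α : ℕ`, each value being taken finitely often. Such a basis exists if and only if the
`L∞`-algebra has these two properties. -/
structure HomogeneousBasis {V : Type*} [AddCommGroup V] [Module ℝ V] (L : LInfinityAlgebra V)
    (ι : Type*) where
  e : Module.Basis ι ℝ V
  depth : ι → ℕ
  e_mem : ∀ α, e α ∈ L.gr (-(depth α : ℤ))
  finite_depth : ∀ k : ℕ, {α | depth α = k}.Finite

namespace HomogeneousBasis

/-- The degree `|t^α| = 1 - |e_α|` of the generator `t^α`, shifted dual to `e_α`. -/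
def tdeg {V : Type*} [AddCommGroup V] [Module ℝ V] {L : LInfinityAlgebra V} {ι : Type*}
    (b : HomogeneousBasis L ι) (α : ι) : ℕ := b.depth α + 1

theorem finite_tdeg_le {V : Type*} [AddCommGroup V] [Module ℝ V] {L : LInfinityAlgebra V}
    {ι : Type*} (b : HomogeneousBasis L ι) (N : ℕ) : {α | b.tdeg α ≤ N}.Finite := by
  refine ((Set.finite_Iic N).biUnion fun k _ => b.finite_depth k).subset fun α hα => ?_
  simp only [Set.mem_ofPred_eq, tdeg] at hα
  simp only [Set.mem_iUnion, Set.mem_ofPred_eq, Set.mem_Iic]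
  exact ⟨b.depth α, by omega, rfl⟩

/-- The Chevalley–Eilenberg algebra `⊙(L[1]^*)` as a graded algebra. -/
abbrev CE {V : Type*} [AddCommGroup V] [Module ℝ V] {L : LInfinityAlgebra V} {ι : Type*}
    (b : HomogeneousBasis L ι) : Type _ := FreeGC b.tdeg

open Classical in
/-- The index tuples `(β₁, …, βₖ)` with `|t^{β₁}| + ⋯ + |t^{βₖ}| = N`. -/
def tuples {V : Type*} [AddCommGroup V] [Module ℝ V] {L : LInfinityAlgebra V} {ι : Type*}
    (b : HomogeneousBasis L ι) (k N : ℕ) : Finset (Fin k → ι) :=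
  {β ∈ Fintype.piFinset (fun _ : Fin k => (b.finite_tdeg_le N).toFinset) |
    ∑ i, b.tdeg (β i) = N}

theorem mem_tuples {V : Type*} [AddCommGroup V] [Module ℝ V] {L : LInfinityAlgebra V} {ι : Type*}
    (b : HomogeneousBasis L ι) (k N : ℕ) (β : Fin k → ι) :
    β ∈ b.tuples k N ↔ ∑ i, b.tdeg (β i) = N := by
  simp only [tuples, Finset.mem_filter, Fintype.mem_piFinset, Set.Finite.mem_toFinset,
    Set.mem_ofPred_eq, and_iff_right_iff_imp]
  intro h i
  rw [← h]
  exact Finset.single_le_sum (f := fun i => b.tdeg (β i)) (fun _ _ => Nat.zero_le _)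
    (Finset.mem_univ i)

/-- The differential of the Chevalley–Eilenberg algebra on generators,
`d t^α = - ∑ₖ 1/k! ∑_β ± μ^α_{β₁…βₖ} t^{β₁} ⋯ t^{βₖ}`, where `μ^α_{β₁…βₖ}` is the `e_α`-coordinate of
`μ k (e_{β₁}, …, e_{βₖ})`. The sign is the one of the shift `L → L[1]`, namely
`(-1) ^ (k ∑ᵢ |t^{βᵢ}| + ∑_{i < j} |t^{βⱼ}| |e_{βᵢ}|)`. Because `μ k` has degree `2 - k`, all
coefficients with `|t^{β₁}| + ⋯ + |t^{βₖ}| ≠ |t^α| + 1` vanish, so that the sum is over the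
remaining, finitely many, index tuples. -/
def dCEgen {V : Type*} [AddCommGroup V] [Module ℝ V] {L : LInfinityAlgebra V} {ι : Type*}
    (b : HomogeneousBasis L ι) (α : ι) : b.CE :=
  -∑ k ∈ Finset.range (b.tdeg α + 2), ∑ β ∈ b.tuples k (b.tdeg α + 1),
    (((-1 : ℝ) ^ (k * ∑ i, b.tdeg (β i)
          + ∑ q : Fin k × Fin k with q.1 < q.2, b.tdeg (β q.2) * b.depth (β q.1))
        / (k.factorial : ℝ)) * b.e.repr (L.μ k (fun i => b.e (β i))) α) •
      ((List.ofFn β).map (FreeGC.gen b.tdeg)).prod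

theorem dCEgen_mem {V : Type*} [AddCommGroup V] [Module ℝ V] {L : LInfinityAlgebra V} {ι : Type*}
    (b : HomogeneousBasis L ι) (α : ι) : b.dCEgen α ∈ FreeGC.homog b.tdeg (b.tdeg α + 1) := by
  refine neg_mem (Submodule.sum_mem _ fun k _ => Submodule.sum_mem _ fun β hβ =>
    Submodule.smul_mem _ _ (FreeGC.word_mem _ ?_))
  rw [mem_tuples] at hβ
  rw [List.map_ofFn, List.sum_ofFn]
  exact hβ

/-- The Chevalley–Eilenberg differential. -/
def dCE {V : Type*} [AddCommGroup V] [Module ℝ V] {L : LInfinityAlgebra V} {ι : Type*}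
    (b : HomogeneousBasis L ι) : b.CE →ₗ[ℝ] b.CE := FreeGC.deriv b.dCEgen b.dCEgen_mem

/-! ## The Weil algebra -/

/-- Degrees of the generators of the Weil algebra: `inl α` is `t^α` and `inr α` is `σ(t^α)`. -/
def wdeg {V : Type*} [AddCommGroup V] [Module ℝ V] {L : LInfinityAlgebra V} {ι : Type*}
    (b : HomogeneousBasis L ι) : ι ⊕ ι → ℕ := Sum.elim b.tdeg (fun α => b.tdeg α + 1)

/-- The Weil algebra `⊙(L[1]^* ⊕ L[2]^*)` as a graded algebra. -/
abbrev Weil {V : Type*} [AddCommGroup V] [Module ℝ V] {L : LInfinityAlgebra V} {ι : Type*}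
    (b : HomogeneousBasis L ι) : Type _ := FreeGC b.wdeg

/-- The generator `t^α` of the Weil algebra. -/
def t {V : Type*} [AddCommGroup V] [Module ℝ V] {L : LInfinityAlgebra V} {ι : Type*}
    (b : HomogeneousBasis L ι) (α : ι) : b.Weil := FreeGC.gen b.wdeg (Sum.inl α)

/-- The generator `σ(t^α)` of the Weil algebra. -/
def st {V : Type*} [AddCommGroup V] [Module ℝ V] {L : LInfinityAlgebra V} {ι : Type*}
    (b : HomogeneousBasis L ι) (α : ι) : b.Weil := FreeGC.gen b.wdeg (Sum.inr α)

/-- The inclusion of graded algebras `CE → Weil`, `t^α ↦ t^α`. -/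
def incl {V : Type*} [AddCommGroup V] [Module ℝ V] {L : LInfinityAlgebra V} {ι : Type*}
    (b : HomogeneousBasis L ι) : b.CE →ₐ[ℝ] b.Weil :=
  FreeGC.lift b.t (fun α β => FreeGC.gen_mul_gen b.wdeg (Sum.inl α) (Sum.inl β))

/-- The projection `Weil → CE`, `t^α ↦ t^α`, `σ(t^α) ↦ 0`. -/
def proj {V : Type*} [AddCommGroup V] [Module ℝ V] {L : LInfinityAlgebra V} {ι : Type*}
    (b : HomogeneousBasis L ι) : b.Weil →ₐ[ℝ] b.CE :=
  FreeGC.lift (Sum.elim (FreeGC.gen b.tdeg) (fun _ => 0)) (by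
    rintro (α | α) (β | β)
    · exact FreeGC.gen_mul_gen b.tdeg α β
    all_goals simp)

theorem incl_mem {V : Type*} [AddCommGroup V] [Module ℝ V] {L : LInfinityAlgebra V} {ι : Type*}
    (b : HomogeneousBasis L ι) {n : ℕ} {a : b.CE} (ha : a ∈ FreeGC.homog b.tdeg n) :
    b.incl a ∈ FreeGC.homog b.wdeg n := by
  induction ha using Submodule.span_induction with
  | zero => simp
  | add x y _ _ hx hy => rw [map_add]; exact add_mem hx hy
  | smul c x _ hx => rw [map_smul]; exact Submodule.smul_mem _ _ hx
  | mem x hx =>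
    obtain ⟨l, hl, rfl⟩ := hx
    have h : b.incl (l.map (FreeGC.gen b.tdeg)).prod
        = ((l.map Sum.inl).map (FreeGC.gen b.wdeg)).prod := by
      rw [map_list_prod, List.map_map, List.map_map]
      congr 1
      refine List.map_congr_left fun α _ => ?_
      exact FreeGC.lift_gen _ _ α
    rw [h]
    refine FreeGC.word_mem _ ?_
    rw [List.map_map, ← hl]
    rfl

/-- The shift `σ` as a nilquadratic derivation of degree `1` on the Weil algebra,
`t^α ↦ σ(t^α) ↦ 0`. -/
def shift {V : Type*} [AddCommGroup V] [Module ℝ V] {L : LInfinityAlgebra V} {ι : Type*}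
    (b : HomogeneousBasis L ι) : b.Weil →ₗ[ℝ] b.Weil :=
  FreeGC.deriv (Sum.elim b.st (fun _ => 0)) (by
    rintro (α | α)
    · exact FreeGC.gen_mem b.wdeg (Sum.inr α)
    · exact zero_mem _)

/-- The differential of the Weil algebra, `d_W t = d_CE t + σ(t)`, `d_W σ(t) = - σ(d_CE t)`
(which is `- σ(d_W t)`, as `σ` squares to zero). -/
def dW {V : Type*} [AddCommGroup V] [Module ℝ V] {L : LInfinityAlgebra V} {ι : Type*}
    (b : HomogeneousBasis L ι) : b.Weil →ₗ[ℝ] b.Weil :=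
  FreeGC.deriv
    (Sum.elim (fun α => b.incl (b.dCE (FreeGC.gen b.tdeg α)) + b.st α)
      (fun α => -b.shift (b.incl (b.dCE (FreeGC.gen b.tdeg α))))) (by
    have h : ∀ α, b.incl (b.dCE (FreeGC.gen b.tdeg α)) ∈ FreeGC.homog b.wdeg (b.tdeg α + 1) :=
      fun α => b.incl_mem (FreeGC.deriv_mem _ _ (FreeGC.gen_mem b.tdeg α))
    rintro (α | α)
    · exact add_mem (h α) (FreeGC.gen_mem b.wdeg (Sum.inr α))
    · exact neg_mem (FreeGC.deriv_mem _ _ (h α)))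

end HomogeneousBasis

/-! ## Differential forms with ghosts on a coordinate patch -/

/-- Extension by zero from an open set to `ℝⁿ` (an auxiliary device to differentiate). -/
def extZero {n : ℕ} {U : TopologicalSpace.Opens (EuclideanSpace ℝ (Fin n))} (f : U → ℝ) :
    EuclideanSpace ℝ (Fin n) → ℝ := Function.extend Subtype.val f (fun _ => 0)

theorem extZero_apply {n : ℕ} {U : TopologicalSpace.Opens (EuclideanSpace ℝ (Fin n))} (f : U → ℝ)
    (x : U) : extZero f x = f x := Subtype.val_injective.extend_apply f (fun _ => 0) x

theorem extZero_apply' {n : ℕ} {U : TopologicalSpace.Opens (EuclideanSpace ℝ (Fin n))} (f : U → ℝ)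
    (y : EuclideanSpace ℝ (Fin n)) (hy : ¬∃ z : U, (z : EuclideanSpace ℝ (Fin n)) = y) :
    extZero f y = 0 := Function.extend_apply' f (fun _ => 0) y hy

/-- The algebra `C^∞(U)` of smooth functions on an open subset `U` of `ℝⁿ`. -/
def smoothFn {n : ℕ} (U : TopologicalSpace.Opens (EuclideanSpace ℝ (Fin n))) :
    Subalgebra ℝ (U → ℝ) where
  carrier := {f | ContDiffOn ℝ ∞ (extZero f) (U : Set (EuclideanSpace ℝ (Fin n)))}
  mul_mem' {f g} hf hg := by
    refine (ContDiffOn.mul hf hg).congr fun x hx => ?_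
    have h : ∀ k : U → ℝ, extZero k x = k ⟨x, hx⟩ := fun k =>
      extZero_apply k ⟨x, hx⟩
    simp [h]
  add_mem' {f g} hf hg := by
    refine (ContDiffOn.add hf hg).congr fun x hx => ?_
    have h : ∀ k : U → ℝ, extZero k x = k ⟨x, hx⟩ := fun k =>
      extZero_apply k ⟨x, hx⟩
    simp [h]
  algebraMap_mem' r := by
    refine (contDiffOn_const (c := r)).congr fun x hx => ?_
    exact extZero_apply _ ⟨x, hx⟩

/-- The partial derivative `∂ᵢ` on `C^∞(U)`. -/
def partialDeriv {n : ℕ} (U : TopologicalSpace.Opens (EuclideanSpace ℝ (Fin n))) (i : Fin n) :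
    smoothFn U →ₗ[ℝ] smoothFn U where
  toFun f := ⟨fun x => fderiv ℝ (extZero f.1) x (EuclideanSpace.single i 1), by
    have h : ContDiffOn ℝ ∞ (fun x => fderiv ℝ (extZero f.1) x
        (EuclideanSpace.single i 1)) (U : Set (EuclideanSpace ℝ (Fin n))) :=
      (ContDiffOn.fderiv_of_isOpen f.2 U.isOpen (by simp)).clm_apply contDiffOn_const
    exact h.congr fun x hx => extZero_apply _ ⟨x, hx⟩⟩
  map_add' f g := by
    ext x
    have hd : ∀ k : smoothFn U,
        DifferentiableAt ℝ (extZero k.1) (x : EuclideanSpace ℝ (Fin n)) :=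
      fun k => (ContDiffOn.contDiffAt k.2 (U.isOpen.mem_nhds x.2)).differentiableAt (by simp)
    have h : extZero (f + g).1
        = extZero f.1 + extZero g.1 := by
      funext y
      by_cases hy : ∃ z : U, (z : EuclideanSpace ℝ (Fin n)) = y
      · obtain ⟨z, rfl⟩ := hy
        simp [extZero_apply]
      · simp [extZero_apply' _ _ hy]
    show fderiv ℝ (extZero (f + g).1) x _ = _
    rw [h, fderiv_add (hd f) (hd g)]
    rfl
  map_smul' c f := by
    ext x
    have hd : DifferentiableAt ℝ (extZero f.1)
        (x : EuclideanSpace ℝ (Fin n)) :=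
      (ContDiffOn.contDiffAt f.2 (U.isOpen.mem_nhds x.2)).differentiableAt (by simp)
    have h : extZero (c • f).1
        = c • extZero f.1 := by
      funext y
      by_cases hy : ∃ z : U, (z : EuclideanSpace ℝ (Fin n)) = y
      · obtain ⟨z, rfl⟩ := hy
        simp [extZero_apply]
      · simp [extZero_apply' _ _ hy]
    show fderiv ℝ (extZero (c • f).1) x _ = _
    rw [h, fderiv_const_smul hd]
    rfl

/-- The forms `dxⁱ` (`inl i`, of degree `1`) and ghost parameters (`inr g`, of degree `gh g`). -/
def fieldDeg (n : ℕ) {Γ : Type} (gh : Γ → ℕ) : Fin n ⊕ Γ → ℕ := Sum.elim (fun _ => 1) gh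

/-- `Ω^•(U) ⊗ G` for an open subset `U` of `ℝⁿ` and the free graded-commutative algebra `G` on
ghost parameters `g : Γ` of ghost degree `gh g`, written as
`C^∞(U) ⊗ ⊙(dx¹, …, dxⁿ, Γ)`. Signs are governed by the total degree, the sum of form degree and
ghost degree. -/
abbrev GhostForms {n : ℕ} (U : TopologicalSpace.Opens (EuclideanSpace ℝ (Fin n))) {Γ : Type}
    (gh : Γ → ℕ) : Type := smoothFn U ⊗[ℝ] FreeGC (fieldDeg n gh)

namespace GhostForms

/-- Elements of total degree `k`. -/
def totalDeg {n : ℕ} (U : TopologicalSpace.Opens (EuclideanSpace ℝ (Fin n))) {Γ : Type}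
    (gh : Γ → ℕ) (k : ℕ) : Submodule ℝ (GhostForms U gh) :=
  Submodule.span ℝ {a | ∃ (f : smoothFn U) (c : FreeGC (fieldDeg n gh)),
    c ∈ FreeGC.homog (fieldDeg n gh) k ∧ a = f ⊗ₜ[ℝ] c}

/-- The part of ghost degree `k`. -/
def ghostPart {n : ℕ} (U : TopologicalSpace.Opens (EuclideanSpace ℝ (Fin n))) {Γ : Type}
    (gh : Γ → ℕ) (k : ℕ) : GhostForms U gh →ₗ[ℝ] GhostForms U gh :=
  LinearMap.lTensor _ (FreeGC.weightPart (fieldDeg n gh) (Sum.elim (fun _ => 0) gh) k)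

/-- The de Rham differential `d_U = ∑ᵢ dxⁱ ∂ᵢ`. -/
def dU {n : ℕ} (U : TopologicalSpace.Opens (EuclideanSpace ℝ (Fin n))) {Γ : Type}
    (gh : Γ → ℕ) : GhostForms U gh →ₗ[ℝ] GhostForms U gh :=
  ∑ i : Fin n, TensorProduct.map (partialDeriv U i)
    (LinearMap.mulLeft ℝ (FreeGC.gen (fieldDeg n gh) (Sum.inl i)))

end GhostForms

/-! ## Adjustments -/

namespace HomogeneousBasis

/-- An automorphism of the Weil algebra as a graded algebra. -/
def IsGradedAut {V : Type*} [AddCommGroup V] [Module ℝ V] {L : LInfinityAlgebra V} {ι : Type*}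
    (b : HomogeneousBasis L ι) (φ : b.Weil ≃ₐ[ℝ] b.Weil) : Prop :=
  ∀ (k : ℕ) (a : b.Weil), a ∈ FreeGC.homog b.wdeg k → φ a ∈ FreeGC.homog b.wdeg k

/-- `φ` covers the identity map of the Chevalley–Eilenberg algebra. -/
def CoversId {V : Type*} [AddCommGroup V] [Module ℝ V] {L : LInfinityAlgebra V} {ι : Type*}
    (b : HomogeneousBasis L ι) (φ : b.Weil ≃ₐ[ℝ] b.Weil) : Prop :=
  ∀ a : b.Weil, b.proj (φ a) = b.proj a

/-- A local `L`-valued connection on `U` together with its ghosts: a morphism of graded algebras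
`𝒜 : Weil → Ω^•(U) ⊗ G`. Its components of ghost degree `0` are the gauge potentials `A^α` and the
curvatures `F^α`, the latter being the curvatures of the `A^α`, i.e. the part of ghost degree `0`
of `(d_U 𝒜 - 𝒜 d_W)(t^α)` vanishes; there is no restriction on the components
`c^α_j` and `d^α_j` of ghost degree `j > 0`. -/
structure ConnectionWithGhosts {V : Type*} [AddCommGroup V] [Module ℝ V] {L : LInfinityAlgebra V}
    {ι : Type*} (b : HomogeneousBasis L ι) {n : ℕ}
    (U : TopologicalSpace.Opens (EuclideanSpace ℝ (Fin n))) {Γ : Type} (gh : Γ → ℕ) where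
  map : b.Weil →ₐ[ℝ] GhostForms U gh
  map_mem : ∀ (k : ℕ) (a : b.Weil), a ∈ FreeGC.homog b.wdeg k →
    map a ∈ GhostForms.totalDeg U gh k
  curvature : ∀ α, GhostForms.ghostPart U gh 0
    (GhostForms.dU U gh (map (b.t α)) - map (b.dW (b.t α))) = 0

namespace ConnectionWithGhosts

/-- The operator `𝒜 ↦ d_U ∘ 𝒜 - 𝒜 ∘ d_W`, whose part of ghost degree `1` is the BRST
differential. -/
def Qhat {V : Type*} [AddCommGroup V] [Module ℝ V] {L : LInfinityAlgebra V}
    {ι : Type*} {b : HomogeneousBasis L ι} {n : ℕ}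
    {U : TopologicalSpace.Opens (EuclideanSpace ℝ (Fin n))} {Γ : Type} {gh : Γ → ℕ}
    (𝒜 : ConnectionWithGhosts b U gh) (a : b.Weil) : GhostForms U gh :=
  GhostForms.dU U gh (𝒜.map a) - 𝒜.map (b.dW a)

/-- The curvature ghost `d^α_j`, the part of ghost degree `j ≥ 1` of `𝒜(φ(σ(t^α)))`. -/
def curvatureGhost {V : Type*} [AddCommGroup V] [Module ℝ V] {L : LInfinityAlgebra V}
    {ι : Type*} {b : HomogeneousBasis L ι} {n : ℕ}
    {U : TopologicalSpace.Opens (EuclideanSpace ℝ (Fin n))} {Γ : Type} {gh : Γ → ℕ}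
    (𝒜 : ConnectionWithGhosts b U gh) (φ : b.Weil ≃ₐ[ℝ] b.Weil) (α : ι) (j : ℕ) :
    GhostForms U gh :=
  GhostForms.ghostPart U gh j (𝒜.map (φ (b.st α)))

/-- The BRST differential of the curvature ghost `d^α_j`, the part of ghost degree `j + 1` of
`(d_U ∘ 𝒜 - 𝒜 ∘ d_W)(φ(σ(t^α)))`. -/
def brstCurvatureGhost {V : Type*} [AddCommGroup V] [Module ℝ V] {L : LInfinityAlgebra V}
    {ι : Type*} {b : HomogeneousBasis L ι} {n : ℕ}
    {U : TopologicalSpace.Opens (EuclideanSpace ℝ (Fin n))} {Γ : Type} {gh : Γ → ℕ}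
    (𝒜 : ConnectionWithGhosts b U gh) (φ : b.Weil ≃ₐ[ℝ] b.Weil) (α : ι) (j : ℕ) :
    GhostForms U gh :=
  GhostForms.ghostPart U gh (j + 1) (𝒜.Qhat (φ (b.st α)))

end ConnectionWithGhosts

/-- The truncated BRST complex closes: on every contractible patch `U`, and for all ghost
parameters, the BRST differential of every curvature ghost vanishes as soon as all curvature
ghosts are put to zero. (This vanishing is local on `U`, so coordinate patches are enough. All
dimensions have to be considered, since products of curvatures vanish in low dimensions.) -/
def TruncatedBRSTCloses {V : Type*} [AddCommGroup V] [Module ℝ V] {L : LInfinityAlgebra V}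
    {ι : Type*} (b : HomogeneousBasis L ι) (φ : b.Weil ≃ₐ[ℝ] b.Weil) : Prop :=
  ∀ (n : ℕ) (U : TopologicalSpace.Opens (EuclideanSpace ℝ (Fin n))), ContractibleSpace U →
    ∀ (Γ : Type) (gh : Γ → ℕ), (∀ g, 0 < gh g) → ∀ 𝒜 : ConnectionWithGhosts b U gh,
      (∀ α j, 1 ≤ j → 𝒜.curvatureGhost φ α j = 0) →
        ∀ α j, 1 ≤ j → 𝒜.brstCurvatureGhost φ α j = 0

/-- `φ` is an adjustment: it is an automorphism of the graded algebra underlying the Weil algebra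
which covers the identity and for which the truncated BRST complex closes. -/
def IsAdjustment {V : Type*} [AddCommGroup V] [Module ℝ V] {L : LInfinityAlgebra V}
    {ι : Type*} (b : HomogeneousBasis L ι) (φ : b.Weil ≃ₐ[ℝ] b.Weil) : Prop :=
  b.IsGradedAut φ ∧ b.CoversId φ ∧ b.TruncatedBRSTCloses φ

end HomogeneousBasis

end HigherGauge

end

/-!
The elements `t^α` and `φ(σ(t^α))` are again free generators of the Weil algebra
(`HomogeneousBasis.adapted`). As `φ` covers the identity, `φ⁻¹` fixes `t^α` up to terms which
contain some `σ(t^β)` and hence only `t^γ` of lower degree, so that the change of generators is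
surjective by induction on the degree; it is injective because the homogeneous components are
finite-dimensional.
Therefore `d_W φ(σ(t^α))` is a polynomial in these generators, and the claim is that the truncated
BRST complex closes if and only if each of its monomials has factors `t^β` of total degree at most
`1`.

If the polynomials have this form, then closure is a count of ghost degrees: once the curvature
ghosts vanish, `φ(σ(t^β))` is mapped to a form without ghosts, and a `t^β` of degree `1` contributes
at most one ghost (`HomogeneousBasis.truncatedBRSTCloses_of_expansion`).

Conversely, the values of connections at a point are unconstrained. By the Poincaré lemma for
constant forms there are gauge potentials on `ℝⁿ` with prescribed value and curvature at the origin,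
and the ghosts are arbitrary, so one may send the `φ(σ(t^β))` to any forms and the `t^β` to any
ghosts of the right degree (`HomogeneousBasis.exists_connection`). In order to read off the
coefficient of a given monomial `y₁ ⋯ y_k`, take products `v₁, …, v_k` of pairwise distinct
generators of degree `1`, forms `dxⁱ` or ghosts according to the type of `y_i`, and send the letter
`x` to the sum of those `v_i` with `y_i = x`. All other monomials of the same degree are then mapped
to zero, and `y₁ ⋯ y_k` is mapped to a positive multiple of `v₁ ⋯ v_k`
(`FreeGC.lift_letterSum_linearCombination`), which does not vanish in the Grassmann algebra
(`FreeGC.word_ne_zero_of_nodup`). Its ghost degree is the total degree of the factors `t^β`, so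
closure forces the coefficient to vanish whenever this degree is at least `2`
(`HomogeneousBasis.coeff_eq_zero_of_closes`).
-/

noncomputable section

namespace HigherGauge

/-! ### Words and weights in free graded-commutative algebras -/

namespace FreeGC

section Words

variable {ι : Type*} {deg : ι → ℕ}

theorem algHom_ext {A : Type*} [Ring A] [Algebra ℝ A] {f g : FreeGC deg →ₐ[ℝ] A}
    (h : ∀ x, f (gen deg x) = g (gen deg x)) : f = g := by
  refine RingQuot.ringQuot_ext' ℝ f g (FreeAlgebra.hom_ext ?_)
  funext x
  exact h x

theorem span_words :
    Submodule.span ℝ (Set.range fun l : List ι => (l.map (gen deg)).prod) = ⊤ := by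
  rw [eq_top_iff]
  rintro a -
  obtain ⟨a, rfl⟩ := RingQuot.mkAlgHom_surjective ℝ (GCRel deg) a
  induction a using FreeAlgebra.induction with
  | grade0 r =>
    rw [AlgHom.commutes, Algebra.algebraMap_eq_smul_one]
    exact Submodule.smul_mem _ _ (Submodule.subset_span ⟨[], rfl⟩)
  | grade1 x =>
    have h : ([x].map (gen deg)).prod = gen deg x := by simp
    exact Submodule.subset_span ⟨[x], h⟩
  | add a b ha hb => rw [map_add]; exact add_mem ha hb
  | mul a b ha hb =>
    rw [map_mul]
    have h := Submodule.mul_mem_mul ha hb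
    rw [Submodule.span_mul_span] at h
    refine Submodule.span_mono ?_ h
    rintro _ ⟨_, ⟨l, rfl⟩, _, ⟨l', rfl⟩, rfl⟩
    exact ⟨l ++ l', by simp⟩

/-- The algebra map `x ↦ x X ^ w x`, whose coefficients are the parts of given weight. -/
def weightHom (deg w : ι → ℕ) : FreeGC deg →ₐ[ℝ] Polynomial (FreeGC deg) :=
  lift (deg := deg) (fun x => Polynomial.monomial (w x) (gen deg x)) (by
    intro x y
    rw [Polynomial.monomial_mul_monomial, Polynomial.monomial_mul_monomial, gen_mul_gen,
      Polynomial.smul_monomial, add_comm])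

theorem weightPart_eq_coeff (w : ι → ℕ) (k : ℕ) (a : FreeGC deg) :
    weightPart deg w k a = (weightHom deg w a).coeff k := rfl

theorem weightHom_word (w : ι → ℕ) (l : List ι) :
    weightHom deg w (l.map (gen deg)).prod
      = Polynomial.monomial (l.map w).sum (l.map (gen deg)).prod := by
  induction l with
  | nil => simp
  | cons x l ih =>
    have hx : weightHom deg w (gen deg x) = Polynomial.monomial (w x) (gen deg x) :=
      lift_gen _ _ x
    simp only [List.map_cons, List.prod_cons, List.sum_cons, map_mul, ih, hx,
      Polynomial.monomial_mul_monomial]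

theorem weightPart_word (w : ι → ℕ) (k : ℕ) (l : List ι) :
    weightPart deg w k (l.map (gen deg)).prod
      = if (l.map w).sum = k then (l.map (gen deg)).prod else 0 := by
  rw [weightPart_eq_coeff, weightHom_word, Polynomial.coeff_monomial]

theorem weightPart_gen (w : ι → ℕ) (k : ℕ) (x : ι) :
    weightPart deg w k (gen deg x) = if w x = k then gen deg x else 0 := by
  simpa using weightPart_word (deg := deg) w k [x]

theorem weightPart_mul (w : ι → ℕ) (k : ℕ) (a b : FreeGC deg) :
    weightPart deg w k (a * b)
      = ∑ p ∈ Finset.HasAntidiagonal.antidiagonal k,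
          weightPart deg w p.1 a * weightPart deg w p.2 b := by
  simp only [weightPart_eq_coeff, map_mul, Polynomial.coeff_mul]

theorem weightPart_weightPart (w : ι → ℕ) (j k : ℕ) (a : FreeGC deg) :
    weightPart deg w j (weightPart deg w k a) = if j = k then weightPart deg w k a else 0 := by
  have ha : a ∈ Submodule.span ℝ (Set.range fun l : List ι => (l.map (gen deg)).prod) := by
    rw [span_words]; trivial
  induction ha using Submodule.span_induction with
  | zero => simp
  | add x y _ _ hx hy => simp only [map_add, hx, hy]; split_ifs <;> simp
  | smul c x _ hx => simp only [map_smul, hx]; split_ifs <;> simp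
  | mem x hx =>
    obtain ⟨l, rfl⟩ := hx
    simp only [weightPart_word]
    split_ifs <;> simp_all [weightPart_word, eq_comm]

theorem exists_sum_weightPart (w : ι → ℕ) (a : FreeGC deg) :
    ∃ N : ℕ, ∀ M, N ≤ M → a = ∑ k ∈ Finset.range M, weightPart deg w k a := by
  have ha : a ∈ Submodule.span ℝ (Set.range fun l : List ι => (l.map (gen deg)).prod) := by
    rw [span_words]; trivial
  induction ha using Submodule.span_induction with
  | zero => exact ⟨0, by simp⟩
  | add x y _ _ hx hy =>
    obtain ⟨N, hN⟩ := hx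
    obtain ⟨N', hN'⟩ := hy
    refine ⟨max N N', fun M hM => ?_⟩
    simp only [map_add, Finset.sum_add_distrib]
    rw [← hN M (le_trans (le_max_left _ _) hM), ← hN' M (le_trans (le_max_right _ _) hM)]
  | smul c x _ hx =>
    obtain ⟨N, hN⟩ := hx
    refine ⟨N, fun M hM => ?_⟩
    simp only [map_smul, ← Finset.smul_sum]
    rw [← hN M hM]
  | mem x hx =>
    obtain ⟨l, rfl⟩ := hx
    refine ⟨(l.map w).sum + 1, fun M hM => ?_⟩
    simp only [weightPart_word]
    rw [Finset.sum_ite_eq, if_pos (Finset.mem_range.2 hM)]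

theorem weightPart_of_mem {n k : ℕ} {a : FreeGC deg} (ha : a ∈ homog deg n) :
    weightPart deg deg k a = if n = k then a else 0 := by
  induction ha using Submodule.span_induction with
  | zero => simp
  | add x y _ _ hx hy => rw [map_add, hx, hy]; split_ifs <;> simp
  | smul c x _ hx => rw [map_smul, hx]; split_ifs <;> simp
  | mem x hx =>
    obtain ⟨l, hl, rfl⟩ := hx
    rw [weightPart_word, hl]

theorem weightPart_mem (k : ℕ) (a : FreeGC deg) : weightPart deg deg k a ∈ homog deg k := by
  have ha : a ∈ Submodule.span ℝ (Set.range fun l : List ι => (l.map (gen deg)).prod) := by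
    rw [span_words]; trivial
  induction ha using Submodule.span_induction with
  | zero => simp
  | add x y _ _ hx hy => rw [map_add]; exact add_mem hx hy
  | smul c x _ hx => rw [map_smul]; exact Submodule.smul_mem _ _ hx
  | mem x hx =>
    obtain ⟨l, rfl⟩ := hx
    rw [weightPart_word]
    split_ifs with h
    · exact word_mem l h
    · exact zero_mem _

/-- An algebra map which sends every generator to an element of the same degree preserves
degrees, for any family of submodules of the target that is compatible with products. -/
theorem map_mem_of_gen {A : Type*} [Ring A] [Algebra ℝ A] (f : FreeGC deg →ₐ[ℝ] A)
    (S : ℕ → Submodule ℝ A) (h1 : 1 ∈ S 0)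
    (hS : ∀ i j a b, a ∈ S i → b ∈ S j → a * b ∈ S (i + j))
    (hf : ∀ x, f (gen deg x) ∈ S (deg x)) {n : ℕ} {a : FreeGC deg} (ha : a ∈ homog deg n) :
    f a ∈ S n := by
  induction ha using Submodule.span_induction with
  | zero => simp
  | add x y _ _ hx hy => rw [map_add]; exact add_mem hx hy
  | smul c x _ hx => rw [map_smul]; exact Submodule.smul_mem _ _ hx
  | mem x hx =>
    obtain ⟨l, hl, rfl⟩ := hx
    induction l generalizing n with
    | nil => subst hl; simpa using h1
    | cons x l ih =>
      subst hl
      simp only [List.map_cons, List.prod_cons, List.sum_cons, map_mul]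
      exact hS _ _ _ _ (hf x) (ih rfl)

theorem one_mem : (1 : FreeGC deg) ∈ homog deg 0 := by
  simpa using word_mem (deg := deg) [] rfl

/-- A graded algebra map commutes with taking homogeneous components. -/
theorem map_weightPart {κ : Type*} {deg' : κ → ℕ} (f : FreeGC deg →ₐ[ℝ] FreeGC deg')
    (hf : ∀ x, f (gen deg x) ∈ homog deg' (deg x)) (k : ℕ) (a : FreeGC deg) :
    f (weightPart deg deg k a) = weightPart deg' deg' k (f a) := by
  have hm : ∀ {n : ℕ} {a : FreeGC deg}, a ∈ homog deg n → f a ∈ homog deg' n := fun ha =>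
    map_mem_of_gen f (homog deg') one_mem (fun _ _ _ _ => mul_mem) hf ha
  have ha : a ∈ Submodule.span ℝ (Set.range fun l : List ι => (l.map (gen deg)).prod) := by
    rw [span_words]; trivial
  induction ha using Submodule.span_induction with
  | zero => simp
  | add x y _ _ hx hy => simp only [map_add, hx, hy]
  | smul c x _ hx => simp only [map_smul, hx]
  | mem x hx =>
    obtain ⟨l, rfl⟩ := hx
    rw [weightPart_of_mem (word_mem l rfl), weightPart_of_mem (hm (word_mem l rfl))]
    split_ifs <;> simp

/-- With positive degrees taken finitely often, the homogeneous components are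
finite-dimensional. -/
theorem finite_homog (hpos : ∀ x, 0 < deg x) (hfin : ∀ N, {x | deg x ≤ N}.Finite) (n : ℕ) :
    Module.Finite ℝ (homog deg n) := by
  -- As degrees are positive, words of degree `n` have at most `n` letters, each of degree at
  -- most `n`.
  have hlen : ∀ l : List ι, l.length ≤ (l.map deg).sum := fun l => by
    induction l with
    | nil => simp
    | cons x l ih => have := hpos x; simp; omega
  have hs : {l : List ι | (l.map deg).sum = n}.Finite := by
    have : Finite {x | deg x ≤ n} := hfin n
    refine ((List.finite_length_le {x | deg x ≤ n} n).image
      (List.map Subtype.val)).subset ?_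
    intro l hl
    have hmem : ∀ x ∈ l, deg x ≤ n := fun x hx => by
      rw [← (show _ = n from hl)]
      exact List.single_le_sum (by simp) _ (List.mem_map_of_mem hx)
    refine ⟨l.attach.map fun x => ⟨x.1, hmem x.1 x.2⟩, ?_, ?_⟩
    · have := hlen l
      rw [show (l.map deg).sum = n from hl] at this
      show List.length _ ≤ n
      simpa using this
    · simp [List.map_map, Function.comp_def]
  refine Module.Finite.of_fg (Submodule.fg_def.2
    ⟨(fun l : List ι => (l.map (gen deg)).prod) '' {l | (l.map deg).sum = n}, hs.image _, ?_⟩)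
  rw [homog]
  congr 1
  ext a
  constructor
  · rintro ⟨l, hl, rfl⟩; exact ⟨l, hl, rfl⟩
  · rintro ⟨l, hl, rfl⟩; exact ⟨l, hl, rfl⟩

/-- A surjective graded endomorphism is injective if the homogeneous components are
finite-dimensional. -/
theorem injective_of_surjective (hpos : ∀ x, 0 < deg x) (hfin : ∀ N, {x | deg x ≤ N}.Finite)
    (f : FreeGC deg →ₐ[ℝ] FreeGC deg) (hf : ∀ x, f (gen deg x) ∈ homog deg (deg x))
    (hsurj : Function.Surjective f) : Function.Injective f := by
  have hm : ∀ n, ∀ a ∈ homog deg n, f a ∈ homog deg n := fun n a ha =>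
    map_mem_of_gen f (homog deg) one_mem (fun _ _ _ _ => mul_mem) hf ha
  have hinj : ∀ n, ∀ a ∈ homog deg n, f a = 0 → a = 0 := by
    intro n a ha h0
    have := finite_homog hpos hfin n
    let g : homog deg n →ₗ[ℝ] homog deg n := f.toLinearMap.restrict (hm n)
    have hg : Function.Surjective g := by
      rintro ⟨c, hc⟩
      obtain ⟨c', rfl⟩ := hsurj c
      refine ⟨⟨weightPart deg deg n c', weightPart_mem n c'⟩, Subtype.ext ?_⟩
      show f (weightPart deg deg n c') = f c'
      rw [map_weightPart f hf, weightPart_of_mem hc, if_pos rfl]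
    have hgi := LinearMap.injective_iff_surjective.2 hg
    have : (⟨a, ha⟩ : homog deg n) = 0 := hgi (Subtype.ext (by
      show f a = (g 0 : homog deg n)
      rw [h0, map_zero]; rfl))
    exact congrArg Subtype.val this
  rw [injective_iff_map_eq_zero]
  intro a ha
  obtain ⟨N, hN⟩ := exists_sum_weightPart deg a
  rw [hN N le_rfl]
  refine Finset.sum_eq_zero fun k _ => hinj k _ (weightPart_mem k a) ?_
  rw [map_weightPart f hf, ha, map_zero]

end Words

/-! ### Graded-commuting families -/

section Families

variable {I : Type*} {A : Type*} [Ring A] [Algebra ℝ A]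

theorem comm_word_of_family {d : I → ℕ} {g : I → A}
    (hg : ∀ i j, g i * g j = (-1 : ℝ) ^ (d i * d j) • (g j * g i)) (i : I) (l : List I) :
    g i * (l.map g).prod = (-1 : ℝ) ^ (d i * (l.map d).sum) • ((l.map g).prod * g i) := by
  have h := congrArg (lift g hg) (gen_comm_word d i l)
  simpa [map_list_prod, lift_gen, List.map_map, Function.comp_def] using h

/-- A word vanishes if it repeats a letter which squares to zero. -/
theorem word_eq_zero_of_duplicate {d : I → ℕ} {g : I → A}
    (hg : ∀ i j, g i * g j = (-1 : ℝ) ^ (d i * d j) • (g j * g i)) {l : List I} {x : I}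
    (hx : l.Duplicate x) (hxx : g x * g x = 0) : (l.map g).prod = 0 := by
  induction hx with
  | cons_mem h =>
    obtain ⟨s, t, rfl⟩ := List.append_of_mem h
    simp only [List.map_cons, List.map_append, List.prod_cons, List.prod_append]
    rw [← mul_assoc, comm_word_of_family hg, smul_mul_assoc, mul_assoc, ← mul_assoc (g x) (g x),
      hxx]
    simp
  | cons_duplicate _ ih => simp [ih]

theorem word_eq_zero_of_not_nodup {d : I → ℕ} {g : I → A}
    (hg : ∀ i j, g i * g j = (-1 : ℝ) ^ (d i * d j) • (g j * g i)) {l : List I}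
    (hl : ¬ l.Nodup) (hsq : ∀ i, g i * g i = 0) : (l.map g).prod = 0 := by
  obtain ⟨x, hx⟩ : ∃ x, l.Duplicate x := by
    by_contra! h
    exact hl (List.nodup_iff_forall_not_duplicate.2 h)
  exact word_eq_zero_of_duplicate hg hx (hsq x)

/-- Words that are permutations of each other agree up to a sign. -/
theorem exists_sign_of_perm {d : I → ℕ} {g : I → A}
    (hg : ∀ i j, g i * g j = (-1 : ℝ) ^ (d i * d j) • (g j * g i)) {l l' : List I}
    (h : l.Perm l') : ∃ n : ℕ, (l.map g).prod = (-1 : ℝ) ^ n • (l'.map g).prod := by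
  induction h with
  | nil => exact ⟨0, by simp⟩
  | cons x _ ih =>
    obtain ⟨n, hn⟩ := ih
    exact ⟨n, by simp [hn]⟩
  | swap x y l =>
    refine ⟨d y * d x, ?_⟩
    simp only [List.map_cons, List.prod_cons]
    rw [← mul_assoc, hg, smul_mul_assoc, mul_assoc]
  | trans _ _ h1 h2 =>
    obtain ⟨n, hn⟩ := h1
    obtain ⟨m, hm⟩ := h2
    exact ⟨n + m, by rw [hn, hm, smul_smul, pow_add]⟩

/-- Letters of even degree can be moved to the front of a word without a sign. -/
theorem word_eq_even_mul_odd {d : I → ℕ} {g : I → A}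
    (hg : ∀ i j, g i * g j = (-1 : ℝ) ^ (d i * d j) • (g j * g i)) (l : List I) :
    (l.map g).prod = ((l.filter fun i => Even (d i)).map g).prod
      * ((l.filter fun i => ¬ Even (d i)).map g).prod := by
  induction l with
  | nil => simp
  | cons x l ih =>
    by_cases hx : Even (d x)
    · simp [hx, ih, mul_assoc]
    · have hev : Even (((l.filter fun i => Even (d i)).map d).sum) := by
        clear ih
        induction l with
        | nil => simp
        | cons y l ih =>
          by_cases hy : Even (d y)
          · simp [hy, Even.add, ih]
          · simpa [hy] using ih
      have := comm_word_of_family hg x (l.filter fun i => Even (d i))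
      rw [Even.neg_one_pow (hev.mul_left _), one_smul] at this
      simp only [List.map_cons, List.prod_cons, ih, List.filter_cons, hx]
      simp only [← mul_assoc, this]
      simp [mul_assoc]

/-- A permutation of a word which moves only letters of even degree does not change it. -/
theorem word_perm_of_odd_fixed {d : I → ℕ} {g : I → A}
    (hg : ∀ i j, g i * g j = (-1 : ℝ) ^ (d i * d j) • (g j * g i)) (l : List I) (τ : I → I)
    (hp : (l.map τ).Perm l) (hd : ∀ i, d (τ i) = d i) (hodd : ∀ i, ¬ Even (d i) → τ i = i) :
    ((l.map τ).map g).prod = (l.map g).prod := by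
  rw [word_eq_even_mul_odd hg (l.map τ), word_eq_even_mul_odd hg l]
  congr 1
  · refine List.Perm.prod_eq' ((hp.filter _).map g) ?_
    rw [List.pairwise_map]
    refine List.Pairwise.imp_of_mem (R := fun _ _ => True) ?_ (List.pairwise_of_forall (by simp))
    intro i j hi _ _
    have hi' : Even (d i) := by simpa using (List.mem_filter.1 hi).2
    show g i * g j = g j * g i
    rw [hg, Even.neg_one_pow (hi'.mul_right _), one_smul]
  · congr 2
    rw [List.filter_map]
    have : ((fun i => decide (¬ Even (d i))) ∘ τ) = fun i => decide (¬ Even (d i)) := by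
      funext i; simp [hd]
    rw [this]
    conv_rhs => rw [← List.map_id (l.filter _)]
    refine List.map_congr_left fun i hi => hodd i ?_
    simpa using (List.mem_filter.1 hi).2

end Families

end FreeGC

/-! ### Separation of words by Grassmann-valued points -/

namespace FreeGC

/-- If all generators are odd, a word without repeated letters is non-zero: it is mapped to a
non-zero element of an exterior algebra. -/
theorem word_ne_zero_of_nodup {Θ : Type*} {deg : Θ → ℕ} (hodd : ∀ x, Odd (deg x)) {l : List Θ}
    (hl : l.Nodup) : (l.map (gen deg)).prod ≠ 0 := by
  classical
  let f : FreeGC deg →ₐ[ℝ] ExteriorAlgebra ℝ (Θ →₀ ℝ) :=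
    lift (fun x => ExteriorAlgebra.ι ℝ (Finsupp.single x 1)) (by
      intro x y
      rw [Odd.neg_one_pow ((hodd x).mul (hodd y)), neg_one_smul]
      exact eq_neg_of_add_eq_zero_left (ExteriorAlgebra.ι_add_mul_swap _ _))
  have hf : f (l.map (gen deg)).prod
      = ExteriorAlgebra.ιMulti ℝ l.length (fun i => Finsupp.single (l.get i) 1) := by
    rw [ExteriorAlgebra.ιMulti_apply, map_list_prod, List.map_map]
    congr 1
    conv_lhs => rw [← List.ofFn_get l, List.map_ofFn]
    congr 1
    funext i
    exact lift_gen _ _ _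
  let p : (Θ →₀ ℝ) →ₗ[ℝ] (Fin l.length → ℝ) :=
    LinearMap.pi fun i => Finsupp.lapply (l.get i)
  let D : ∀ i, (Θ →₀ ℝ) [⋀^Fin i]→ₗ[ℝ] ℝ :=
    Function.update 0 l.length (Matrix.detRowAlternating.compLinearMap p)
  intro h0
  -- The determinant of the coordinates with respect to the letters of `l` detects the product.
  have h1 : ExteriorAlgebra.liftAlternating D (f (l.map (gen deg)).prod) = 1 := by
    rw [hf, ExteriorAlgebra.liftAlternating_apply_ιMulti]
    have hD : D l.length = Matrix.detRowAlternating.compLinearMap p := Function.update_self _ _ _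
    rw [hD, AlternatingMap.compLinearMap_apply]
    have : (fun i => p (Finsupp.single (l.get i) 1)) = (1 : Matrix _ _ ℝ) := by
      funext i j
      simp only [p, LinearMap.pi_apply, Finsupp.lapply_apply, Finsupp.single_apply,
        Matrix.one_apply, List.Nodup.get_inj_iff hl]
    rw [this]
    exact Matrix.det_one
  rw [h0] at h1
  simp at h1

theorem gen_sq_of_odd {X : Type*} {deg : X → ℕ} {x : X} (hx : Odd (deg x)) :
    gen deg x * gen deg x = 0 := by
  have h := gen_mul_gen deg x x
  rw [Odd.neg_one_pow (hx.mul hx), neg_one_smul] at h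
  have h2 : (2 : ℝ) • (gen deg x * gen deg x) = 0 := by
    rw [two_smul]
    nth_rewrite 1 [h]
    exact neg_add_cancel _
  exact (smul_eq_zero.1 h2).resolve_left two_ne_zero

section Separation

variable {X : Type*} {deg : X → ℕ} {k : ℕ} {y : Fin k → X} {A : Type*} [Ring A] [Algebra ℝ A]

open Classical in
/-- The substitution which replaces the letter `x` by the sum of those `v i` for which the `i`-th letter
of the word `y` is `x`. -/
def letterSum (y : Fin k → X) (v : Fin k → A) (x : X) : A := ∑ i with y i = x, v i

theorem letterSum_mem {v : Fin k → A} (S : Submodule ℝ A) {x : X}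
    (h : ∀ i, y i = x → v i ∈ S) : letterSum y v x ∈ S := by
  classical
  exact Submodule.sum_mem _ fun i hi => h i (Finset.mem_filter.1 hi).2

variable {v : Fin k → A}
  (hv : ∀ i j, v i * v j = (-1 : ℝ) ^ (deg (y i) * deg (y j)) • (v j * v i))

include hv in
theorem letterSum_comm (x z : X) : letterSum y v x * letterSum y v z
    = (-1 : ℝ) ^ (deg x * deg z) • (letterSum y v z * letterSum y v x) := by
  classical
  rw [letterSum, letterSum, Finset.sum_mul_sum, Finset.sum_mul_sum, Finset.sum_comm,
    Finset.smul_sum]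
  refine Finset.sum_congr rfl fun j hj => ?_
  rw [Finset.smul_sum]
  refine Finset.sum_congr rfl fun i hi => ?_
  rw [hv, (Finset.mem_filter.1 hi).2, (Finset.mem_filter.1 hj).2]

open Classical in
theorem prod_letterSum {m : ℕ} (w : Fin m → X) :
    (List.ofFn fun a => letterSum y v (w a)).prod
      = ∑ τ : Fin m → Fin k with ∀ a, y (τ a) = w a, (List.ofFn fun a => v (τ a)).prod := by
  have h := MultilinearMap.map_sum_finset (MultilinearMap.mkPiAlgebraFin ℝ m A)
    (fun _ i => v i) (fun a => Finset.univ.filter fun i => y i = w a)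
  simp only [MultilinearMap.mkPiAlgebraFin_apply] at h
  simp only [letterSum]
  rw [h]
  refine Finset.sum_congr ?_ fun _ _ => rfl
  ext τ
  simp [Fintype.mem_piFinset]

include hv in
theorem prod_eq_zero_of_not_injective (hsq : ∀ i, v i * v i = 0) {m : ℕ} {τ : Fin m → Fin k}
    (hτ : ¬ Function.Injective τ) : (List.ofFn fun a => v (τ a)).prod = 0 := by
  have h := word_eq_zero_of_not_nodup (d := fun i => deg (y i)) (g := v) hv
    (l := List.ofFn τ) (by rwa [List.nodup_ofFn]) hsq
  rwa [List.map_ofFn] at h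

include hv in
/-- A word of the same degree as `y` is killed by the substitution `letterSum y v`, unless it is a
permutation of `y`. -/
theorem word_letterSum_eq_zero (hpos : ∀ x, 0 < deg x) (hsq : ∀ i, v i * v i = 0) {l : List X}
    (hdeg : (l.map deg).sum = ((List.ofFn y).map deg).sum) (hl : ¬ l.Perm (List.ofFn y)) :
    (l.map (letterSum y v)).prod = 0 := by
  classical
  have hl' : l.map (letterSum y v) = List.ofFn fun a => letterSum y v (l.get a) := by
    conv_lhs => rw [← List.ofFn_get l, List.map_ofFn]
    rfl
  rw [hl', prod_letterSum]
  refine Finset.sum_eq_zero fun τ hτ => ?_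
  replace hτ := (Finset.mem_filter.1 hτ).2
  -- A non-zero term comes from an injective `τ`, which is surjective because both words have the
  -- same degree; so `l` is the word `y` permuted by `τ`.
  refine prod_eq_zero_of_not_injective hv hsq fun hinj => hl ?_
  have hsurj : Function.Surjective τ := by
    intro i
    by_contra hi
    have hlt := Finset.sum_lt_sum_of_subset (f := fun i => deg (y i))
      (Finset.subset_univ (Finset.univ.image τ)) (i := i) (Finset.mem_univ _)
      (by simpa using hi) (hpos _) (fun _ _ _ => Nat.zero_le _)
    rw [Finset.sum_image (fun _ _ _ _ h => hinj h)] at hlt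
    rw [List.map_ofFn, List.sum_ofFn, ← List.ofFn_get l, List.map_ofFn, List.sum_ofFn] at hdeg
    simp only [Function.comp_apply, ← hτ] at hdeg
    exact hlt.ne hdeg
  have hk : l.length = k := by
    simpa using Fintype.card_of_bijective ⟨hinj, hsurj⟩
  subst hk
  have hp := Equiv.Perm.ofFn_comp_perm (Equiv.ofBijective τ ⟨hinj, hsurj⟩) y
  have he : y ∘ (Equiv.ofBijective τ ⟨hinj, hsurj⟩) = l.get := funext fun a => hτ a
  rw [he, List.ofFn_get] at hp
  exact hp

include hv in
/-- The substitution `letterSum y v` maps the word `y` to a positive multiple of the product of all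
`v i`, provided that no odd letter is repeated in `y`. -/
theorem word_letterSum_self (hsq : ∀ i, v i * v i = 0)
    (hy : ∀ i j, ¬ Even (deg (y i)) → y i = y j → i = j) :
    ∃ N : ℕ, 0 < N ∧
      ((List.ofFn y).map (letterSum y v)).prod = (N : ℝ) • (List.ofFn v).prod := by
  classical
  have hl' : (List.ofFn y).map (letterSum y v) = List.ofFn fun a => letterSum y v (y a) := by
    rw [List.map_ofFn]; rfl
  rw [hl', prod_letterSum]
  have h : ∀ τ ∈ (Finset.univ.filter fun τ : Fin k → Fin k => ∀ a, y (τ a) = y a),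
      (List.ofFn fun a => v (τ a)).prod
        = if Function.Injective τ then (List.ofFn v).prod else 0 := by
    intro τ hτ
    replace hτ := (Finset.mem_filter.1 hτ).2
    split_ifs with hinj
    · have hp : ((List.ofFn id).map τ).Perm (List.ofFn (id : Fin k → Fin k)) := by
        have := Equiv.Perm.ofFn_comp_perm
          (Equiv.ofBijective τ (Finite.injective_iff_bijective.1 hinj)) (id : Fin k → Fin k)
        rw [List.map_ofFn]
        exact this
      have := word_perm_of_odd_fixed (d := fun i => deg (y i)) (g := v) hv (List.ofFn id) τ hp
        (fun i => by rw [hτ]) (fun i hi => (hy i (τ i) hi (hτ i).symm).symm)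
      simpa only [List.map_ofFn, Function.comp_def, id] using this
    · exact prod_eq_zero_of_not_injective hv hsq hinj
  rw [Finset.sum_congr rfl h, ← Finset.sum_filter, Finset.sum_const, ← Nat.cast_smul_eq_nsmul ℝ]
  refine ⟨_, Finset.card_pos.2 ⟨id, ?_⟩, rfl⟩
  simp [Function.injective_id]

/-- The representative words: one word for every multiset of letters in which no odd letter is
repeated. -/
def word (deg : X → ℕ) (M : Multiset X) : FreeGC deg := (M.toList.map (gen deg)).prod

/-- The multisets of total degree `n` in which no odd letter is repeated. -/
def monomials (deg : X → ℕ) (n : ℕ) : Set (Multiset X) :=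
  {M | (M.map deg).sum = n ∧ ∀ x ∈ M, ¬ Even (deg x) → ¬ M.toList.Duplicate x}

theorem homog_le_span_word (n : ℕ) :
    homog deg n ≤ Submodule.span ℝ (word deg '' monomials deg n) := by
  refine Submodule.span_le.2 ?_
  rintro _ ⟨l, hl, rfl⟩
  have hp : l.Perm (l : Multiset X).toList := Multiset.coe_eq_coe.1 (Multiset.coe_toList _).symm
  obtain ⟨s, hs⟩ := exists_sign_of_perm (gen_mul_gen deg) hp
  rw [hs]
  refine Submodule.smul_mem _ _ ?_
  by_cases hM : (l : Multiset X) ∈ monomials deg n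
  · exact Submodule.subset_span ⟨_, hM, rfl⟩
  · have : ∃ x, ¬ Even (deg x) ∧ (l : Multiset X).toList.Duplicate x := by
      by_contra! h
      exact hM ⟨by simpa using hl, fun x _ hx => h x hx⟩
    obtain ⟨x, hx, hd⟩ := this
    rw [word_eq_zero_of_duplicate (gen_mul_gen deg) hd
      (gen_sq_of_odd (Nat.not_even_iff_odd.1 hx))]
    exact zero_mem _

include hv in
/-- The substitution `letterSum y v` reads off the coefficient of the monomial `y`. -/
theorem lift_letterSum_linearCombination (hpos : ∀ x, 0 < deg x) (hsq : ∀ i, v i * v i = 0)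
    {n : ℕ} {c : Multiset X →₀ ℝ} (hc : c ∈ Finsupp.supported ℝ ℝ (monomials deg n))
    {M : Multiset X} (hM : M ∈ monomials deg n) (hyM : List.ofFn y = M.toList) :
    ∃ N : ℕ, 0 < N ∧ lift (letterSum y v) (letterSum_comm hv)
      (Finsupp.linearCombination ℝ (word deg) c) = (c M * N) • (List.ofFn v).prod := by
  have hy : ∀ i j, ¬ Even (deg (y i)) → y i = y j → i = j := by
    intro i j hi hij
    by_contra hne
    have hmem : y i ∈ M := by
      rw [← Multiset.mem_toList, ← hyM]; exact (List.mem_ofFn' _ _).2 ⟨i, rfl⟩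
    refine hM.2 _ hmem hi ?_
    rw [← hyM]
    rw [List.duplicate_iff_exists_distinct_get]
    rcases lt_or_gt_of_ne hne with h | h
    · exact ⟨⟨i, by simp⟩, ⟨j, by simp⟩, h, by simp, by simp [hij]⟩
    · exact ⟨⟨j, by simp⟩, ⟨i, by simp⟩, h, by simp [hij], by simp⟩
  obtain ⟨N, hN, hself⟩ := word_letterSum_self hv hsq hy
  refine ⟨N, hN, ?_⟩
  have hword : ∀ M', lift (letterSum y v) (letterSum_comm hv) (word deg M')
      = (M'.toList.map (letterSum y v)).prod := by
    intro M'
    rw [word, map_list_prod, List.map_map]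
    congr 1
    exact List.map_congr_left fun x _ => lift_gen _ _ x
  have hsum : ∀ M' : Multiset X, (M'.toList.map deg).sum = (M'.map deg).sum := fun M' => by
    conv_rhs => rw [← Multiset.coe_toList M']
    simp
  rw [Finsupp.linearCombination_apply, Finsupp.sum, map_sum, Finset.sum_eq_single M]
  · rw [map_smul, hword, ← hyM, hself, smul_smul]
  · intro M' hM' hne
    rw [map_smul, hword, word_letterSum_eq_zero hv hpos hsq, smul_zero]
    · rw [hyM, hsum, hsum, hM.1, ((Finsupp.mem_supported _ _).1 hc hM').1]
    · rw [hyM]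
      intro hp
      apply hne
      rw [← Multiset.coe_toList M', ← Multiset.coe_toList M]
      exact Multiset.coe_eq_coe.2 hp
  · intro h
    rw [Finsupp.notMem_support_iff.1 h, zero_smul, map_zero]

end Separation

section Blocks

variable {Θ : Type*} {D : Θ → ℕ} {k : ℕ} {d : Fin k → ℕ}

/-- The product of the generators in the `i`-th block of a family indexed by blocks. -/
def block (D : Θ → ℕ) (θ : (Σ i : Fin k, Fin (d i)) → Θ) (i : Fin k) : FreeGC D :=
  ((List.ofFn fun j : Fin (d i) => θ ⟨i, j⟩).map (gen D)).prod

variable (hD : ∀ x, D x = 1) {θ : (Σ i : Fin k, Fin (d i)) → Θ}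

include hD in
theorem block_mem (i : Fin k) : block D θ i ∈ homog D (d i) :=
  word_mem _ (by simp [List.map_ofFn, Function.comp_def, hD])

include hD in
theorem block_sq (hd : ∀ i, 0 < d i) (i : Fin k) : block D θ i * block D θ i = 0 := by
  rw [block, ← List.prod_append, ← List.map_append]
  have hmem : θ ⟨i, ⟨0, hd i⟩⟩ ∈ List.ofFn fun j : Fin (d i) => θ ⟨i, j⟩ :=
    (List.mem_ofFn' _ _).2 ⟨_, rfl⟩
  refine word_eq_zero_of_not_nodup (gen_mul_gen D) (fun h => ?_)
    (fun x => gen_sq_of_odd (by rw [hD]; exact odd_one))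
  exact (List.nodup_append.1 h).2.2 _ hmem _ hmem rfl

theorem prod_block_eq_word : (List.ofFn (block D θ)).prod
    = (((List.finRange k).flatMap fun i => List.ofFn fun j : Fin (d i) => θ ⟨i, j⟩).map
      (gen D)).prod := by
  rw [List.map_flatMap, List.flatMap_def, List.prod_flatten, List.map_map, List.ofFn_eq_map]
  rfl

theorem weightPart_block (w : Θ → ℕ) (q : ℕ) (i : Fin k) :
    weightPart D w q (block D θ i) = if ∑ j, w (θ ⟨i, j⟩) = q then block D θ i else 0 := by
  rw [block, weightPart_word, List.map_ofFn, List.sum_ofFn]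
  rfl

theorem weightPart_prod_block (w : Θ → ℕ) :
    weightPart D w (∑ i, ∑ j, w (θ ⟨i, j⟩)) (List.ofFn (block D θ)).prod
      = (List.ofFn (block D θ)).prod := by
  rw [prod_block_eq_word, weightPart_word, if_pos]
  rw [List.map_flatMap, List.flatMap_def, List.sum_flatten, List.map_map, ← List.ofFn_eq_map,
    List.sum_ofFn]
  refine Finset.sum_congr rfl fun i _ => ?_
  simp only [Function.comp_apply, List.map_ofFn, List.sum_ofFn]

include hD in
theorem prod_block_ne_zero (hθ : Function.Injective θ) : (List.ofFn (block D θ)).prod ≠ 0 := by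
  rw [prod_block_eq_word]
  refine word_ne_zero_of_nodup (fun x => by rw [hD]; exact odd_one) ?_
  rw [List.nodup_flatMap]
  refine ⟨fun i _ => List.nodup_ofFn.2 fun a b hab => by simpa using hθ hab, ?_⟩
  refine (List.nodup_finRange k).imp fun {i j} hij => ?_
  intro x hx hx'
  obtain ⟨a, rfl⟩ := (List.mem_ofFn' _ _).1 hx
  obtain ⟨b, hb⟩ := (List.mem_ofFn' _ _).1 hx'
  exact hij (congrArg Sigma.fst (hθ hb)).symm

end Blocks

end FreeGC

/-! ### The adapted generators of the Weil algebra -/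

namespace FreeGC

theorem symm_mem {ι : Type*} {deg : ι → ℕ} (f : FreeGC deg ≃ₐ[ℝ] FreeGC deg)
    (hf : ∀ (k : ℕ) (a : FreeGC deg), a ∈ homog deg k → f a ∈ homog deg k) (k : ℕ)
    (a : FreeGC deg) (ha : a ∈ homog deg k) : f.symm a ∈ homog deg k := by
  have h : weightPart deg deg k (f.symm a) = f.symm a := by
    apply f.injective
    have := map_weightPart (f : FreeGC deg →ₐ[ℝ] FreeGC deg)
      (fun x => hf _ _ (gen_mem deg x)) k (f.symm a)
    refine this.trans ?_
    show weightPart deg deg k (f (f.symm a)) = _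
    rw [AlgEquiv.apply_symm_apply, weightPart_of_mem ha, if_pos rfl]
  rw [← h]
  exact weightPart_mem k _

theorem surjective_of_gen_mem_range {ι : Type*} {deg : ι → ℕ} {A : Type*} [Ring A] [Algebra ℝ A]
    (f : A →ₐ[ℝ] FreeGC deg) (hf : ∀ x, gen deg x ∈ f.range) : Function.Surjective f := by
  intro a
  have ha : a ∈ Submodule.span ℝ (Set.range fun l : List ι => (l.map (gen deg)).prod) := by
    rw [span_words]; trivial
  change a ∈ f.range
  induction ha using Submodule.span_induction with
  | zero => exact zero_mem _
  | add x y _ _ hx hy => exact add_mem hx hy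
  | smul c x _ hx => exact f.range.smul_mem hx c
  | mem x hx =>
    obtain ⟨l, rfl⟩ := hx
    refine f.range.list_prod_mem fun y hy => ?_
    obtain ⟨x, -, rfl⟩ := List.mem_map.1 hy
    exact hf x

end FreeGC

namespace HomogeneousBasis

variable {V : Type*} [AddCommGroup V] [Module ℝ V] {L : LInfinityAlgebra V} {ι : Type*}
  (b : HomogeneousBasis L ι)

theorem wdeg_pos (x : ι ⊕ ι) : 0 < b.wdeg x := by
  rcases x with α | α <;> simp [wdeg, tdeg]

theorem finite_wdeg_le (N : ℕ) : {x | b.wdeg x ≤ N}.Finite := by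
  refine (((b.finite_tdeg_le N).image Sum.inl).union
    ((b.finite_tdeg_le N).image Sum.inr)).subset ?_
  rintro (α | α) hα
  · exact Or.inl ⟨α, hα, rfl⟩
  · refine Or.inr ⟨α, ?_, rfl⟩
    have : b.tdeg α + 1 ≤ N := hα
    show b.tdeg α ≤ N
    omega

theorem t_mem (α : ι) : b.t α ∈ FreeGC.homog b.wdeg (b.tdeg α) :=
  FreeGC.gen_mem b.wdeg (Sum.inl α)

theorem st_mem (α : ι) : b.st α ∈ FreeGC.homog b.wdeg (b.tdeg α + 1) :=
  FreeGC.gen_mem b.wdeg (Sum.inr α)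

theorem incl_gen (α : ι) : b.incl (FreeGC.gen b.tdeg α) = b.t α := FreeGC.lift_gen _ _ α

/-- A homogeneous element in the kernel of the projection to the Chevalley–Eilenberg algebra is a
combination of words each of which contains some `σ(t^β)`. -/
theorem mem_span_of_proj_eq_zero {n : ℕ} {a : b.Weil} (ha : a ∈ FreeGC.homog b.wdeg n)
    (h0 : b.proj a = 0) : a ∈ Submodule.span ℝ {c : b.Weil | ∃ l : List (ι ⊕ ι),
      (l.map b.wdeg).sum = n ∧ (∃ β, Sum.inr β ∈ l) ∧ c = (l.map (FreeGC.gen b.wdeg)).prod} := by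
  suffices h : a - b.incl (b.proj a) ∈ Submodule.span ℝ {c : b.Weil | ∃ l : List (ι ⊕ ι),
      (l.map b.wdeg).sum = n ∧ (∃ β, Sum.inr β ∈ l) ∧
        c = (l.map (FreeGC.gen b.wdeg)).prod} by
    simpa [h0] using h
  clear h0
  induction ha using Submodule.span_induction with
  | zero => simp
  | add x y _ _ hx hy =>
    simp only [map_add]
    rw [add_sub_add_comm]
    exact add_mem hx hy
  | smul c x _ hx =>
    simp only [map_smul]
    rw [← smul_sub]
    exact Submodule.smul_mem _ _ hx
  | mem x hx =>
    obtain ⟨l, hl, rfl⟩ := hx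
    by_cases h : ∃ β, Sum.inr β ∈ l
    · have : b.proj (l.map (FreeGC.gen b.wdeg)).prod = 0 := by
        obtain ⟨β, hβ⟩ := h
        rw [map_list_prod]
        refine List.prod_eq_zero ?_
        rw [List.map_map]
        exact List.mem_map.2 ⟨_, hβ, FreeGC.lift_gen _ _ _⟩
      rw [this, map_zero, sub_zero]
      exact Submodule.subset_span ⟨l, hl, h, rfl⟩
    · have : b.incl (b.proj (l.map (FreeGC.gen b.wdeg)).prod)
          = (l.map (FreeGC.gen b.wdeg)).prod := by
        rw [map_list_prod, map_list_prod, List.map_map, List.map_map]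
        congr 1
        refine List.map_congr_left fun x hx => ?_
        rcases x with α | α
        · show b.incl (b.proj (FreeGC.gen b.wdeg (Sum.inl α))) = _
          rw [proj, FreeGC.lift_gen]
          exact b.incl_gen α
        · exact absurd ⟨α, hx⟩ h
      rw [this, sub_self]
      exact zero_mem _

variable (φ : b.Weil ≃ₐ[ℝ] b.Weil) (hφ : b.IsGradedAut φ) (hid : b.CoversId φ)

/-- The images of the generators under the change of generators to `t^α` and `φ(σ(t^α))`. -/
def adaptedGen (φ : b.Weil ≃ₐ[ℝ] b.Weil) : ι ⊕ ι → b.Weil :=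
  Sum.elim b.t (fun α => φ (b.st α))

include hφ in
theorem adaptedGen_mem (x : ι ⊕ ι) : b.adaptedGen φ x ∈ FreeGC.homog b.wdeg (b.wdeg x) := by
  rcases x with α | α
  · exact b.t_mem α
  · exact hφ _ _ (b.st_mem α)

/-- The graded algebra map `t^α ↦ t^α`, `σ(t^α) ↦ φ(σ(t^α))`. -/
def adaptedHom : b.Weil →ₐ[ℝ] b.Weil :=
  FreeGC.lift (b.adaptedGen φ) fun x y =>
    FreeGC.graded_comm (b.adaptedGen_mem φ hφ x) (b.adaptedGen_mem φ hφ y)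

theorem adaptedHom_gen (x : ι ⊕ ι) :
    b.adaptedHom φ hφ (FreeGC.gen b.wdeg x) = b.adaptedGen φ x := FreeGC.lift_gen _ _ x

include hid in
/-- The `t^α` and `φ(σ(t^α))` generate the Weil algebra: modulo the ideal of the `σ(t^β)` the map
`φ⁻¹` fixes `t^α`, and the correction involves only `t^γ` of lower degree. -/
theorem adaptedHom_surjective : Function.Surjective (b.adaptedHom φ hφ) := by
  let χ : b.Weil →ₐ[ℝ] b.Weil := (φ.symm : b.Weil →ₐ[ℝ] b.Weil).comp (b.adaptedHom φ hφ)
  have hst : ∀ α, b.st α ∈ χ.range := fun α => ⟨b.st α, by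
    show φ.symm (b.adaptedHom φ hφ (FreeGC.gen b.wdeg (Sum.inr α))) = _
    rw [adaptedHom_gen]
    exact φ.symm_apply_apply _⟩
  have ht : ∀ N, ∀ α, b.tdeg α = N → b.t α ∈ χ.range := by
    intro N
    induction N using Nat.strong_induction_on with
    | _ N ih =>
      rintro α rfl
      have hχ : χ (b.t α) = φ.symm (b.t α) := by
        show φ.symm (b.adaptedHom φ hφ (FreeGC.gen b.wdeg (Sum.inl α))) = _
        rw [adaptedHom_gen]; rfl
      have h1 : φ.symm (b.t α) - b.t α ∈ FreeGC.homog b.wdeg (b.tdeg α) :=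
        sub_mem (FreeGC.symm_mem φ hφ _ _ (b.t_mem α)) (b.t_mem α)
      have h2 : b.proj (φ.symm (b.t α) - b.t α) = 0 := by
        rw [map_sub, ← hid (φ.symm (b.t α)), AlgEquiv.apply_symm_apply, sub_self]
      have h3 : φ.symm (b.t α) - b.t α ∈ χ.range := by
        refine (Submodule.span_le (p := χ.range.toSubmodule)).2 ?_
          (b.mem_span_of_proj_eq_zero h1 h2)
        rintro _ ⟨l, hl, ⟨β, hβ⟩, rfl⟩
        refine χ.range.list_prod_mem fun y hy => ?_
        obtain ⟨x, hx, rfl⟩ := List.mem_map.1 hy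
        rcases x with γ | γ
        · refine ih (b.tdeg γ) ?_ γ rfl
          have hne : (Sum.inl γ : ι ⊕ ι) ≠ Sum.inr β := by simp
          obtain ⟨s, u, rfl⟩ := List.append_of_mem hx
          have hβ' : Sum.inr β ∈ s ++ u := by
            simp only [List.mem_append, List.mem_cons, hne.symm, false_or] at hβ ⊢
            exact hβ
          have hle := List.single_le_sum (l := (s ++ u).map b.wdeg) (by simp) _
            (List.mem_map_of_mem hβ')
          have hγ : b.wdeg (Sum.inl γ) = b.tdeg γ := rfl
          have hβ'' : b.wdeg (Sum.inr β) = b.tdeg β + 1 := rfl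
          simp only [List.map_append, List.map_cons, List.sum_append, List.sum_cons] at hl hle
          omega
        · exact hst γ
      have := sub_mem (show χ (b.t α) ∈ χ.range from ⟨_, rfl⟩) h3
      rwa [hχ, sub_sub_cancel] at this
  have hs : Function.Surjective χ := FreeGC.surjective_of_gen_mem_range χ (by
    rintro (α | α)
    · exact ht _ α rfl
    · exact hst α)
  intro a
  obtain ⟨c, hc⟩ := hs (φ.symm a)
  exact ⟨c, φ.symm.injective hc⟩

/-- The change of generators: the Weil algebra is freely generated by `t^α` and `φ(σ(t^α))`. -/
def adapted : b.Weil ≃ₐ[ℝ] b.Weil :=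
  AlgEquiv.ofBijective (b.adaptedHom φ hφ)
    ⟨FreeGC.injective_of_surjective b.wdeg_pos b.finite_wdeg_le _
      (fun x => by rw [adaptedHom_gen]; exact b.adaptedGen_mem φ hφ x)
      (b.adaptedHom_surjective φ hφ hid), b.adaptedHom_surjective φ hφ hid⟩

theorem adapted_gen (x : ι ⊕ ι) :
    b.adapted φ hφ hid (FreeGC.gen b.wdeg x) = b.adaptedGen φ x := b.adaptedHom_gen φ hφ x

theorem adapted_mem (k : ℕ) (a : b.Weil) (ha : a ∈ FreeGC.homog b.wdeg k) :
    b.adapted φ hφ hid a ∈ FreeGC.homog b.wdeg k :=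
  FreeGC.map_mem_of_gen (b.adapted φ hφ hid : b.Weil →ₐ[ℝ] b.Weil) (FreeGC.homog b.wdeg)
    FreeGC.one_mem (fun _ _ _ _ => FreeGC.mul_mem)
    (fun x => (b.adapted_gen φ hφ hid x).symm ▸ b.adaptedGen_mem φ hφ x) ha

end HomogeneousBasis

/-! ### Forms with ghosts -/

namespace GhostForms

instance {n : ℕ} (U : TopologicalSpace.Opens (EuclideanSpace ℝ (Fin n))) {Γ : Type}
    (gh : Γ → ℕ) : AddCommGroup (GhostForms U gh) := TensorProduct.addCommGroup

instance {n : ℕ} (U : TopologicalSpace.Opens (EuclideanSpace ℝ (Fin n))) {Γ : Type}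
    (gh : Γ → ℕ) : Module ℝ (GhostForms U gh) := TensorProduct.leftModule

instance {n : ℕ} (U : TopologicalSpace.Opens (EuclideanSpace ℝ (Fin n))) {Γ : Type}
    (gh : Γ → ℕ) : Ring (GhostForms U gh) := Algebra.TensorProduct.instRing

instance {n : ℕ} (U : TopologicalSpace.Opens (EuclideanSpace ℝ (Fin n))) {Γ : Type}
    (gh : Γ → ℕ) : IsScalarTower ℝ (GhostForms U gh) (GhostForms U gh) :=
  IsScalarTower.right

variable {n : ℕ} (U : TopologicalSpace.Opens (EuclideanSpace ℝ (Fin n))) {Γ : Type} (gh : Γ → ℕ)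

/-- The ghost degrees of the forms `dxⁱ` and of the ghost parameters. -/
abbrev ghostWeight (n : ℕ) {Γ : Type} (gh : Γ → ℕ) : Fin n ⊕ Γ → ℕ := Sum.elim (fun _ => 0) gh

theorem tmul_mem {k : ℕ} (f : smoothFn U) {c : FreeGC (fieldDeg n gh)}
    (hc : c ∈ FreeGC.homog (fieldDeg n gh) k) : f ⊗ₜ[ℝ] c ∈ totalDeg U gh k :=
  Submodule.subset_span ⟨f, c, hc, rfl⟩

theorem one_mem : (1 : GhostForms U gh) ∈ totalDeg U gh 0 :=
  tmul_mem U gh 1 FreeGC.one_mem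

variable {U gh}

theorem mul_mem {i j : ℕ} {x y : GhostForms U gh} (hx : x ∈ totalDeg U gh i)
    (hy : y ∈ totalDeg U gh j) : x * y ∈ totalDeg U gh (i + j) := by
  have h := Submodule.mul_mem_mul hx hy
  rw [totalDeg, totalDeg, Submodule.span_mul_span] at h
  refine Submodule.span_mono ?_ h
  rintro _ ⟨_, ⟨f, c, hc, rfl⟩, _, ⟨g, d, hd, rfl⟩, rfl⟩
  exact ⟨f * g, c * d, FreeGC.mul_mem hc hd, Algebra.TensorProduct.tmul_mul_tmul _ _ _ _⟩

theorem graded_comm {i j : ℕ} {x y : GhostForms U gh} (hx : x ∈ totalDeg U gh i)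
    (hy : y ∈ totalDeg U gh j) : x * y = (-1 : ℝ) ^ (i * j) • (y * x) := by
  induction hx using Submodule.span_induction with
  | zero => simp
  | add x y _ _ hx hy => rw [add_mul, mul_add, hx, hy, smul_add]
  | smul c x _ hx => rw [smul_mul_assoc, hx, mul_smul_comm, smul_comm]
  | mem x hx =>
    obtain ⟨f, c, hc, rfl⟩ := hx
    induction hy using Submodule.span_induction with
    | zero => simp
    | add x y _ _ hx hy => rw [mul_add, add_mul, hx, hy, smul_add]
    | smul c x _ hx => rw [smul_mul_assoc, mul_smul_comm, hx, smul_comm]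
    | mem y hy =>
      obtain ⟨g, d, hd, rfl⟩ := hy
      rw [Algebra.TensorProduct.tmul_mul_tmul, Algebra.TensorProduct.tmul_mul_tmul,
        FreeGC.graded_comm hc hd, mul_comm f g, TensorProduct.tmul_smul]

@[simp]
theorem ghostPart_tmul (k : ℕ) (f : smoothFn U) (c : FreeGC (fieldDeg n gh)) :
    ghostPart U gh k (f ⊗ₜ[ℝ] c)
      = f ⊗ₜ[ℝ] FreeGC.weightPart (fieldDeg n gh) (ghostWeight n gh) k c := rfl

theorem dU_tmul (f : smoothFn U) (c : FreeGC (fieldDeg n gh)) :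
    dU U gh (f ⊗ₜ[ℝ] c)
      = ∑ i, partialDeriv U i f ⊗ₜ[ℝ] (FreeGC.gen (fieldDeg n gh) (Sum.inl i) * c) := by
  simp [dU, LinearMap.sum_apply]

theorem ghostPart_mul (k : ℕ) (x y : GhostForms U gh) :
    ghostPart U gh k (x * y)
      = ∑ p ∈ Finset.HasAntidiagonal.antidiagonal k,
          ghostPart U gh p.1 x * ghostPart U gh p.2 y := by
  induction x using TensorProduct.induction_on with
  | zero => simp
  | add x x' hx hx' => simp only [add_mul, map_add, hx, hx', Finset.sum_add_distrib]
  | tmul f c =>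
    induction y using TensorProduct.induction_on with
    | zero => simp
    | add x x' hx hx' => simp only [mul_add, map_add, hx, hx', Finset.sum_add_distrib]
    | tmul g d =>
      simp only [Algebra.TensorProduct.tmul_mul_tmul, ghostPart_tmul, FreeGC.weightPart_mul,
        TensorProduct.tmul_sum]

theorem ghostPart_ghostPart (j k : ℕ) (x : GhostForms U gh) :
    ghostPart U gh j (ghostPart U gh k x) = if j = k then ghostPart U gh k x else 0 := by
  induction x using TensorProduct.induction_on with
  | zero => simp
  | add x y hx hy => simp only [map_add, hx, hy]; split_ifs <;> simp
  | tmul f c =>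
    simp only [ghostPart_tmul, FreeGC.weightPart_weightPart]
    split_ifs <;> simp

theorem exists_sum_ghostPart (x : GhostForms U gh) :
    ∃ N : ℕ, ∀ M, N ≤ M → x = ∑ k ∈ Finset.range M, ghostPart U gh k x := by
  induction x using TensorProduct.induction_on with
  | zero => exact ⟨0, by simp⟩
  | add x y hx hy =>
    obtain ⟨N, hN⟩ := hx
    obtain ⟨N', hN'⟩ := hy
    refine ⟨max N N', fun M hM => ?_⟩
    simp only [map_add, Finset.sum_add_distrib]
    rw [← hN M (le_trans (le_max_left _ _) hM), ← hN' M (le_trans (le_max_right _ _) hM)]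
  | tmul f c =>
    obtain ⟨N, hN⟩ := FreeGC.exists_sum_weightPart (ghostWeight n gh) c
    refine ⟨N, fun M hM => ?_⟩
    simp only [ghostPart_tmul, ← TensorProduct.tmul_sum]
    rw [← hN M hM]

/-- The parts of positive ghost degree vanish exactly for the elements of ghost degree `0`. -/
theorem ghostPart_zero_eq_self_iff {x : GhostForms U gh} :
    ghostPart U gh 0 x = x ↔ ∀ j, 1 ≤ j → ghostPart U gh j x = 0 := by
  constructor
  · intro h j hj
    rw [← h, ghostPart_ghostPart, if_neg (by omega)]
  · intro h
    obtain ⟨N, hN⟩ := exists_sum_ghostPart x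
    conv_rhs => rw [hN (N + 1) (by omega), Finset.sum_range_succ']
    rw [Finset.sum_eq_zero fun k _ => h (k + 1) (by omega), zero_add]

theorem ghostPart_mul_of_ghostFree (k : ℕ) (x : GhostForms U gh) {y : GhostForms U gh}
    (hy : ghostPart U gh 0 y = y) :
    ghostPart U gh k (x * y) = ghostPart U gh k x * y := by
  rw [ghostPart_mul, Finset.sum_eq_single (k, 0)]
  · rw [hy]
  · rintro ⟨i, j⟩ hij hne
    have : i + j = k := by simpa using hij
    rw [ghostPart_zero_eq_self_iff.1 hy j (by
      rcases Nat.eq_zero_or_pos j with rfl | h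
      · exact absurd (by simp [← this]) hne
      · exact h), mul_zero]
  · simp

theorem ghostPart_one : ghostPart U gh 0 (1 : GhostForms U gh) = 1 := by
  rw [Algebra.TensorProduct.one_def, ghostPart_tmul]
  congr 1
  simpa using FreeGC.weightPart_word (deg := fieldDeg n gh) (ghostWeight n gh) 0 []

variable (U gh) in
/-- Putting all ghosts to zero is an algebra map. -/
def ghostZero : GhostForms U gh →ₐ[ℝ] GhostForms U gh :=
  AlgHom.ofLinearMap (ghostPart U gh 0) ghostPart_one fun x y => by
    rw [ghostPart_mul]; simp

theorem ghostZero_apply (x : GhostForms U gh) : ghostZero U gh x = ghostPart U gh 0 x := rfl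

theorem ghostPart_dU (k : ℕ) (x : GhostForms U gh) :
    ghostPart U gh k (dU U gh x) = dU U gh (ghostPart U gh k x) := by
  induction x using TensorProduct.induction_on with
  | zero => simp
  | add x y hx hy => simp only [map_add, hx, hy]
  | tmul f c =>
    simp only [ghostPart_tmul, dU_tmul, map_sum]
    refine Finset.sum_congr rfl fun i _ => ?_
    congr 1
    rw [FreeGC.weightPart_mul, Finset.sum_eq_single (0, k)]
    · simp [FreeGC.weightPart_gen]
    · rintro ⟨p, q⟩ hpq hne
      have : p + q = k := by simpa using hpq
      rw [FreeGC.weightPart_gen, if_neg, zero_mul]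
      rintro rfl
      exact hne (by simpa using this)
    · simp

theorem dU_mem {k : ℕ} {x : GhostForms U gh} (hx : x ∈ totalDeg U gh k) :
    dU U gh x ∈ totalDeg U gh (k + 1) := by
  induction hx using Submodule.span_induction with
  | zero => simp
  | add x y _ _ hx hy => rw [map_add]; exact add_mem hx hy
  | smul c x _ hx => rw [map_smul]; exact Submodule.smul_mem _ _ hx
  | mem x hx =>
    obtain ⟨f, c, hc, rfl⟩ := hx
    rw [dU_tmul]
    refine Submodule.sum_mem _ fun i _ => tmul_mem U gh _ ?_
    have := FreeGC.mul_mem (FreeGC.gen_mem (fieldDeg n gh) (Sum.inl i)) hc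
    rwa [add_comm] at this

/-- The ghost degree is at most the total degree. -/
theorem ghostPart_eq_zero_of_lt {k j : ℕ} (hkj : k < j) {x : GhostForms U gh}
    (hx : x ∈ totalDeg U gh k) : ghostPart U gh j x = 0 := by
  induction hx using Submodule.span_induction with
  | zero => simp
  | add x y _ _ hx hy => rw [map_add, hx, hy, add_zero]
  | smul c x _ hx => rw [map_smul, hx, smul_zero]
  | mem x hx =>
    obtain ⟨f, c, hc, rfl⟩ := hx
    rw [ghostPart_tmul]
    suffices h : FreeGC.weightPart (fieldDeg n gh) (ghostWeight n gh) j c = 0 by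
      rw [h, TensorProduct.tmul_zero]
    induction hc using Submodule.span_induction with
    | zero => simp
    | add x y _ _ hx hy => rw [map_add, hx, hy, add_zero]
    | smul c x _ hx => rw [map_smul, hx, smul_zero]
    | mem c hc =>
      obtain ⟨l, hl, rfl⟩ := hc
      rw [FreeGC.weightPart_word, if_neg]
      have hle : (l.map (ghostWeight n gh)).sum ≤ (l.map (fieldDeg n gh)).sum := by
        refine List.sum_le_sum fun x _ => ?_
        rcases x with i | g <;> simp [fieldDeg]
      omega

variable (U gh) in
/-- The value at a point, `f ⊗ c ↦ f(p) c`. -/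
def evalAt (p : U) : GhostForms U gh →ₐ[ℝ] FreeGC (fieldDeg n gh) :=
  Algebra.TensorProduct.lift
    ((Algebra.ofId ℝ _).comp ((Pi.evalAlgHom ℝ (fun _ : U => ℝ) p).comp (smoothFn U).val))
    (AlgHom.id ℝ _) (fun f c => Algebra.commutes (f.1 p) c)

theorem evalAt_tmul (p : U) (f : smoothFn U) (c : FreeGC (fieldDeg n gh)) :
    evalAt U gh p (f ⊗ₜ[ℝ] c) = f.1 p • c := by
  rw [Algebra.smul_def]
  exact Algebra.TensorProduct.lift_tmul _ _ _ _ _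

theorem evalAt_one_tmul (p : U) (c : FreeGC (fieldDeg n gh)) :
    evalAt U gh p (1 ⊗ₜ[ℝ] c) = c := by
  rw [evalAt_tmul]
  exact one_smul ℝ c

theorem evalAt_ghostPart (p : U) (k : ℕ) (x : GhostForms U gh) :
    evalAt U gh p (ghostPart U gh k x)
      = FreeGC.weightPart (fieldDeg n gh) (ghostWeight n gh) k (evalAt U gh p x) := by
  induction x using TensorProduct.induction_on with
  | zero => simp
  | add x y hx hy => simp only [map_add, hx, hy]
  | tmul f c => simp only [ghostPart_tmul, evalAt_tmul, map_smul]

/-- The coordinate functions on `ℝⁿ`. -/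
def coord (n : ℕ) (i : Fin n) :
    smoothFn (⊤ : TopologicalSpace.Opens (EuclideanSpace ℝ (Fin n))) :=
  ⟨fun x => x.1 i, by
    have h : ContDiff ℝ ∞ (fun x : EuclideanSpace ℝ (Fin n) => x i) := by fun_prop
    exact h.contDiffOn.congr fun x hx => extZero_apply _ ⟨x, hx⟩⟩

theorem partialDeriv_coord (i j : Fin n) :
    partialDeriv ⊤ i (coord n j) = if i = j then 1 else 0 := by
  have h : extZero (coord n j).1 = EuclideanSpace.proj (𝕜 := ℝ) j := by
    funext x
    exact extZero_apply (U := ⊤) _ ⟨x, trivial⟩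
  ext x
  show fderiv ℝ (extZero (coord n j).1) x (EuclideanSpace.single i 1) = _
  rw [h, ContinuousLinearMap.fderiv]
  split_ifs with hij
  · subst hij; simp
  · simp [Ne.symm hij]

/-- The Poincaré lemma for constant forms: a homogeneous element of positive degree with constant
coefficients and without ghosts has a primitive with linear coefficients. -/
theorem exists_primitive (hgh : ∀ g, 0 < gh g) {k : ℕ} {c : FreeGC (fieldDeg n gh)}
    (hc : c ∈ FreeGC.homog (fieldDeg n gh) (k + 1)) :
    ∃ a ∈ totalDeg ⊤ gh k, ghostPart ⊤ gh 0 a = a ∧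
      dU ⊤ gh a = 1 ⊗ₜ[ℝ] FreeGC.weightPart (fieldDeg n gh) (ghostWeight n gh) 0 c ∧
      evalAt ⊤ gh ⟨0, trivial⟩ a = 0 := by
  induction hc using Submodule.span_induction with
  | zero => exact ⟨0, by simp⟩
  | add x y _ _ hx hy =>
    obtain ⟨a, h1, h2, h3, h4⟩ := hx
    obtain ⟨a', h1', h2', h3', h4'⟩ := hy
    exact ⟨a + a', add_mem h1 h1', by rw [map_add, h2, h2'],
      by rw [map_add, h3, h3', map_add, TensorProduct.tmul_add], by rw [map_add, h4, h4', add_zero]⟩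
  | smul r x _ hx =>
    obtain ⟨a, h1, h2, h3, h4⟩ := hx
    exact ⟨r • a, Submodule.smul_mem _ _ h1, by rw [map_smul, h2],
      by rw [map_smul, h3, map_smul, TensorProduct.tmul_smul], by rw [map_smul, h4, smul_zero]⟩
  | mem x hx =>
    obtain ⟨l, hl, rfl⟩ := hx
    rcases l with _ | ⟨z, l⟩
    · simp at hl
    rw [FreeGC.weightPart_word]
    split_ifs with hw
    · rcases z with i | g
      · refine ⟨coord n i ⊗ₜ[ℝ] (l.map (FreeGC.gen (fieldDeg n gh))).prod,
          tmul_mem _ _ _ (FreeGC.word_mem l ?_), ?_, ?_, ?_⟩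
        · simp [fieldDeg] at hl
          exact add_left_cancel (hl.trans (add_comm _ _))
        · rw [ghostPart_tmul, FreeGC.weightPart_word, if_pos]
          simpa using hw
        · simp only [dU_tmul, partialDeriv_coord]
          rw [Finset.sum_eq_single i]
          · rw [if_pos rfl, List.map_cons, List.prod_cons]
          · intro j _ hj
            rw [if_neg hj, TensorProduct.zero_tmul]
          · exact fun h => absurd (Finset.mem_univ i) h
        · rw [evalAt_tmul]
          exact zero_smul ℝ _
      · have := hgh g
        simp at hw
        omega
    · exact ⟨0, by simp⟩

end GhostForms

/-! ### Connections with prescribed values at a point -/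

namespace HomogeneousBasis

open GhostForms

variable {V : Type*} [AddCommGroup V] [Module ℝ V] {L : LInfinityAlgebra V} {ι : Type*}
  (b : HomogeneousBasis L ι)

theorem dW_t (α : ι) : b.dW (b.t α) = b.incl (b.dCE (FreeGC.gen b.tdeg α)) + b.st α :=
  FreeGC.deriv_gen _ _ (Sum.inl α)

theorem dW_mem {k : ℕ} {a : b.Weil} (ha : a ∈ FreeGC.homog b.wdeg k) :
    b.dW a ∈ FreeGC.homog b.wdeg (k + 1) := FreeGC.deriv_mem _ _ ha

variable (φ : b.Weil ≃ₐ[ℝ] b.Weil) (hφ : b.IsGradedAut φ) (hid : b.CoversId φ)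

theorem adapted_symm_t (α : ι) : (b.adapted φ hφ hid).symm (b.t α) = b.t α := by
  rw [AlgEquiv.symm_apply_eq]
  exact (b.adapted_gen φ hφ hid (Sum.inl α)).symm

/-- Any gauge potentials without ghosts extend to a graded algebra map out of the Weil algebra
which sends `σ(t^α)` to the curvature. -/
theorem exists_curvatureHom {n : ℕ} {U : TopologicalSpace.Opens (EuclideanSpace ℝ (Fin n))}
    {Γ : Type} {gh : Γ → ℕ} (a : ι → GhostForms U gh)
    (ha : ∀ α, a α ∈ totalDeg U gh (b.tdeg α)) (ha0 : ∀ α, ghostPart U gh 0 (a α) = a α) :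
    ∃ A : b.Weil →ₐ[ℝ] GhostForms U gh, (∀ α, A (b.t α) = a α) ∧
      (∀ α, A (b.dW (b.t α)) = dU U gh (a α)) ∧
      (∀ k c, c ∈ FreeGC.homog b.wdeg k → A c ∈ totalDeg U gh k) ∧
      ∀ c, ghostPart U gh 0 (A c) = A c := by
  let aCE : b.CE →ₐ[ℝ] GhostForms U gh :=
    FreeGC.lift a fun α β => graded_comm (ha α) (ha β)
  have haCE : ∀ α, aCE (FreeGC.gen b.tdeg α) = a α := FreeGC.lift_gen _ _
  have haCEmem : ∀ {k : ℕ} {c : b.CE}, c ∈ FreeGC.homog b.tdeg k → aCE c ∈ totalDeg U gh k :=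
    fun hc => FreeGC.map_mem_of_gen aCE (totalDeg U gh) (one_mem U gh)
      (fun _ _ _ _ => mul_mem) (fun α => by rw [haCE]; exact ha α) hc
  have haCE0 : (ghostZero U gh).comp aCE = aCE := FreeGC.algHom_ext fun α => by
    rw [AlgHom.comp_apply, haCE, ghostZero_apply, ha0]
  let f : ι ⊕ ι → GhostForms U gh :=
    Sum.elim a fun α => dU U gh (a α) - aCE (b.dCE (FreeGC.gen b.tdeg α))
  have hf : ∀ x, f x ∈ totalDeg U gh (b.wdeg x) := by
    rintro (α | α)
    · exact ha α
    · exact sub_mem (dU_mem (ha α)) (haCEmem (FreeGC.deriv_mem _ _ (FreeGC.gen_mem _ _)))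
  have hf0 : ∀ x, ghostPart U gh 0 (f x) = f x := by
    rintro (α | α)
    · exact ha0 α
    · show ghostPart U gh 0 (dU U gh (a α) - aCE (b.dCE (FreeGC.gen b.tdeg α))) = _
      rw [map_sub, ghostPart_dU, ha0, ← ghostZero_apply, ← AlgHom.comp_apply, haCE0]
      rfl
  let A : b.Weil →ₐ[ℝ] GhostForms U gh :=
    FreeGC.lift f fun x y => graded_comm (hf x) (hf y)
  have hA : ∀ x, A (FreeGC.gen b.wdeg x) = f x := FreeGC.lift_gen _ _
  have hAincl : A.comp b.incl = aCE := FreeGC.algHom_ext fun α => by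
    rw [AlgHom.comp_apply, haCE, incl_gen]
    exact hA (Sum.inl α)
  have hA0 : (ghostZero U gh).comp A = A := FreeGC.algHom_ext fun x => by
    rw [AlgHom.comp_apply, hA, ghostZero_apply, hf0]
  refine ⟨A, fun α => hA (Sum.inl α), fun α => ?_, fun k c hc => ?_, fun c => ?_⟩
  · rw [dW_t, map_add, ← AlgHom.comp_apply, hAincl]
    have : A (b.st α) = dU U gh (a α) - aCE (b.dCE (FreeGC.gen b.tdeg α)) := hA (Sum.inr α)
    rw [this, add_sub_cancel]
  · exact FreeGC.map_mem_of_gen A (totalDeg U gh) (one_mem U gh) (fun _ _ _ _ => mul_mem)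
      (fun x => by rw [hA]; exact hf x) hc
  · exact DFunLike.congr_fun hA0 c

/-- Algebra maps out of the Weil algebra agree if they agree on all `t^α` and all `d_W t^α`. -/
theorem weil_hom_ext {A : Type*} [Ring A] [Algebra ℝ A] {f g : b.Weil →ₐ[ℝ] A}
    (ht : ∀ α, f (b.t α) = g (b.t α)) (hd : ∀ α, f (b.dW (b.t α)) = g (b.dW (b.t α))) :
    f = g := by
  have hincl : f.comp b.incl = g.comp b.incl := FreeGC.algHom_ext fun α => by
    simp only [AlgHom.comp_apply, incl_gen]
    exact ht α
  refine FreeGC.algHom_ext ?_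
  rintro (α | α)
  · exact ht α
  · have h := hd α
    rw [dW_t, map_add, map_add, ← AlgHom.comp_apply, ← AlgHom.comp_apply, hincl] at h
    exact add_left_cancel h

include hid in
/-- Every graded algebra map from the Weil algebra, written in the generators `t^α` and
`φ(σ(t^α))`, to constant forms with ghosts is the value at the origin of a connection with
vanishing curvature ghosts, provided that it has no ghosts on `φ(σ(t^α))` and nothing but ghosts
on `t^α`. -/
theorem exists_connection {n : ℕ} {Γ : Type} {gh : Γ → ℕ} (hgh : ∀ g, 0 < gh g)
    (F : b.Weil →ₐ[ℝ] FreeGC (fieldDeg n gh))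
    (hF : ∀ x, F (FreeGC.gen b.wdeg x) ∈ FreeGC.homog (fieldDeg n gh) (b.wdeg x))
    (hFt : ∀ α, FreeGC.weightPart (fieldDeg n gh) (ghostWeight n gh) 0 (F (b.t α)) = 0)
    (hFs : ∀ α, FreeGC.weightPart (fieldDeg n gh) (ghostWeight n gh) 0 (F (b.st α))
      = F (b.st α)) :
    ∃ 𝒜 : ConnectionWithGhosts b (⊤ : TopologicalSpace.Opens (EuclideanSpace ℝ (Fin n))) gh,
      (∀ α, ghostPart ⊤ gh 0 (𝒜.map (φ (b.st α))) = 𝒜.map (φ (b.st α))) ∧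
        ∀ a, evalAt ⊤ gh ⟨0, trivial⟩ (𝒜.map (b.adapted φ hφ hid a)) = F a := by
  let Ψ := b.adapted φ hφ hid
  have hΨs : ∀ α, Ψ (b.st α) = φ (b.st α) := fun α => b.adapted_gen φ hφ hid (Sum.inr α)
  have hΨt : ∀ α, Ψ (b.t α) = b.t α := fun α => b.adapted_gen φ hφ hid (Sum.inl α)
  have hΨsymm : ∀ k a, a ∈ FreeGC.homog b.wdeg k → Ψ.symm a ∈ FreeGC.homog b.wdeg k :=
    FreeGC.symm_mem Ψ (b.adapted_mem φ hφ hid)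
  have hFm : ∀ k a, a ∈ FreeGC.homog b.wdeg k → F a ∈ FreeGC.homog (fieldDeg n gh) k :=
    fun k a ha => FreeGC.map_mem_of_gen F (FreeGC.homog (fieldDeg n gh)) FreeGC.one_mem
      (fun _ _ _ _ => FreeGC.mul_mem) hF ha
  -- Linear gauge potentials, vanishing at the origin, whose derivatives are the constant
  -- forms that `F` prescribes for `d_W t^α`.
  choose a ha ha0 had hae using fun α => exists_primitive hgh (hFm _ _ (hΨsymm _ _
    (b.dW_mem (b.t_mem α))))
  obtain ⟨A, hAt, hAd, hAm, hA0⟩ := b.exists_curvatureHom a ha ha0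
  -- At the origin, `A` is the ghost-free part of `F`, read in the original generators.
  have hAev : ∀ c, evalAt ⊤ gh ⟨0, trivial⟩ (A c)
      = FreeGC.weightPart (fieldDeg n gh) (ghostWeight n gh) 0 (F (Ψ.symm c)) := by
    have h : (evalAt ⊤ gh ⟨0, trivial⟩).comp A = (evalAt ⊤ gh ⟨0, trivial⟩).comp
        ((ghostZero ⊤ gh).comp (Algebra.TensorProduct.includeRight.comp
          (F.comp (Ψ.symm : b.Weil →ₐ[ℝ] b.Weil)))) := by
      refine b.weil_hom_ext (fun α => ?_) (fun α => ?_)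
      · show evalAt ⊤ gh ⟨0, trivial⟩ (A (b.t α))
          = evalAt ⊤ gh ⟨0, trivial⟩ (1 ⊗ₜ[ℝ] FreeGC.weightPart (fieldDeg n gh)
            (ghostWeight n gh) 0 (F (Ψ.symm (b.t α))))
        rw [hAt, hae, evalAt_one_tmul, b.adapted_symm_t φ hφ hid, hFt]
      · show evalAt ⊤ gh ⟨0, trivial⟩ (A (b.dW (b.t α)))
          = evalAt ⊤ gh ⟨0, trivial⟩ (1 ⊗ₜ[ℝ] FreeGC.weightPart (fieldDeg n gh)
            (ghostWeight n gh) 0 (F (Ψ.symm (b.dW (b.t α)))))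
        rw [hAd, had]
    intro c
    refine (DFunLike.congr_fun h c).trans ?_
    exact evalAt_one_tmul _ _
  let B₀ : ι ⊕ ι → GhostForms (⊤ : TopologicalSpace.Opens (EuclideanSpace ℝ (Fin n))) gh :=
    Sum.elim (fun α => a α + 1 ⊗ₜ[ℝ] F (b.t α)) (fun α => A (φ (b.st α)))
  have hB₀ : ∀ x, B₀ x ∈ totalDeg ⊤ gh (b.wdeg x) := by
    rintro (α | α)
    · exact add_mem (ha α) (tmul_mem _ _ _ (hF (Sum.inl α)))
    · exact hAm _ _ (hφ _ _ (b.st_mem α))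
  let B : b.Weil →ₐ[ℝ] GhostForms ⊤ gh :=
    FreeGC.lift B₀ fun x y => graded_comm (hB₀ x) (hB₀ y)
  have hB : ∀ x, B (FreeGC.gen b.wdeg x) = B₀ x := FreeGC.lift_gen _ _
  -- Discarding the ghosts gives back `A`, whose values on `σ(t^α)` are the curvatures.
  have hB0 : ∀ c, ghostPart ⊤ gh 0 (B (Ψ.symm c)) = A c := by
    have h : (ghostZero ⊤ gh).comp B = A.comp (Ψ : b.Weil →ₐ[ℝ] b.Weil) := by
      refine FreeGC.algHom_ext ?_
      rintro (α | α)
      · show ghostPart ⊤ gh 0 (B (FreeGC.gen b.wdeg (Sum.inl α))) = A (Ψ (b.t α))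
        rw [hB, hΨt, hAt]
        show ghostPart ⊤ gh 0 (a α + 1 ⊗ₜ[ℝ] F (b.t α)) = _
        rw [map_add, ha0, ghostPart_tmul, hFt, TensorProduct.tmul_zero, add_zero]
      · show ghostPart ⊤ gh 0 (B (FreeGC.gen b.wdeg (Sum.inr α))) = A (Ψ (b.st α))
        rw [hB, hΨs]
        exact hA0 _
    intro c
    refine (DFunLike.congr_fun h (Ψ.symm c)).trans ?_
    show A (Ψ (Ψ.symm c)) = A c
    rw [AlgEquiv.apply_symm_apply]
  refine ⟨⟨B.comp (Ψ.symm : b.Weil →ₐ[ℝ] b.Weil), fun k c hc => ?_, fun α => ?_⟩,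
    fun α => ?_, fun c => ?_⟩
  · exact FreeGC.map_mem_of_gen B (totalDeg ⊤ gh) (one_mem ⊤ gh) (fun _ _ _ _ => mul_mem)
      (fun x => by rw [hB]; exact hB₀ x) (hΨsymm _ _ hc)
  · show ghostPart ⊤ gh 0 (dU ⊤ gh (B (Ψ.symm (b.t α))) - B (Ψ.symm (b.dW (b.t α)))) = 0
    rw [map_sub, ghostPart_dU, hB0, hB0, hAt, hAd, sub_self]
  · show ghostPart ⊤ gh 0 (B (Ψ.symm (φ (b.st α)))) = B (Ψ.symm (φ (b.st α)))
    have : B (Ψ.symm (φ (b.st α))) = A (φ (b.st α)) := by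
      rw [← hΨs, AlgEquiv.symm_apply_apply]
      exact (hB (Sum.inr α)).trans (congrArg A (hΨs α).symm)
    rw [this, hA0]
  · show evalAt ⊤ gh ⟨0, trivial⟩ (B (Ψ.symm (Ψ c))) = F c
    rw [AlgEquiv.symm_apply_apply]
    have h : (evalAt ⊤ gh ⟨0, trivial⟩).comp B = F := by
      refine FreeGC.algHom_ext ?_
      rintro (α | α)
      · show evalAt ⊤ gh ⟨0, trivial⟩ (B (FreeGC.gen b.wdeg (Sum.inl α))) = F (b.t α)
        rw [hB]
        show evalAt ⊤ gh ⟨0, trivial⟩ (a α + 1 ⊗ₜ[ℝ] F (b.t α)) = _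
        rw [map_add, hae, evalAt_one_tmul, zero_add]
      · show evalAt ⊤ gh ⟨0, trivial⟩ (B (FreeGC.gen b.wdeg (Sum.inr α))) = F (b.st α)
        rw [hB]
        show evalAt ⊤ gh ⟨0, trivial⟩ (A (φ (b.st α))) = _
        rw [hAev, ← hΨs, AlgEquiv.symm_apply_apply, hFs]
    exact DFunLike.congr_fun h c

end HomogeneousBasis

/-! ### Adjustments -/

namespace HomogeneousBasis

open GhostForms

variable {V : Type*} [AddCommGroup V] [Module ℝ V] {L : LInfinityAlgebra V} {ι : Type*}
  (b : HomogeneousBasis L ι)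

/-- The degree of the generators `t^α`, the generators `σ(t^α)` being given weight `0`. -/
def tWeight : ι ⊕ ι → ℕ := Sum.elim b.tdeg fun _ => 0

/-- The product of the elements `φ(σ(t^β))` for `β` in a list. -/
def stWord (φ : b.Weil ≃ₐ[ℝ] b.Weil) (l : List ι) : b.Weil := (l.map fun β => φ (b.st β)).prod

variable (φ : b.Weil ≃ₐ[ℝ] b.Weil) (hφ : b.IsGradedAut φ) (hid : b.CoversId φ)

/-- Once the curvature ghosts are put to zero, products of `φ(σ(t^β))` have no ghosts, and at most
one ghost is contributed by a single `t^α` of degree `1`. -/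
theorem truncatedBRSTCloses_of_expansion
    (h : ∀ α : ι, ∃ (m : List ι →₀ ℝ) (n : ι × List ι →₀ ℝ),
      (∀ α₀ l, b.tdeg α₀ ≠ 1 → n (α₀, l) = 0) ∧
      b.dW (φ (b.st α)) =
        (m.sum fun l c => (c / (l.length.factorial : ℝ)) • b.stWord φ l) +
        (n.sum fun p c => (c / (p.2.length.factorial : ℝ)) • (b.t p.1 * b.stWord φ p.2))) :
    b.TruncatedBRSTCloses φ := by
  intro n U _ Γ gh hgh 𝒜 hd α j hj
  have hs : ∀ β, ghostPart U gh 0 (𝒜.map (φ (b.st β))) = 𝒜.map (φ (b.st β)) := fun β =>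
    ghostPart_zero_eq_self_iff.2 (hd β)
  have hw : ∀ l, ghostPart U gh 0 (𝒜.map (b.stWord φ l)) = 𝒜.map (b.stWord φ l) := by
    intro l
    rw [← ghostZero_apply, stWord, map_list_prod, map_list_prod, List.map_map, List.map_map,
      List.map_map]
    congr 1
    exact List.map_congr_left fun β _ => hs β
  obtain ⟨m, c, hc, hP⟩ := h α
  show ghostPart U gh (j + 1) (dU U gh (𝒜.map (φ (b.st α))) - 𝒜.map (b.dW (φ (b.st α)))) = 0
  rw [map_sub, ghostPart_dU, ghostPart_zero_eq_self_iff.1 (hs α) _ (by omega), map_zero, zero_sub,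
    neg_eq_zero, hP, map_add, map_add, Finsupp.sum, Finsupp.sum, map_sum, map_sum, map_sum, map_sum]
  rw [Finset.sum_eq_zero, Finset.sum_eq_zero, add_zero]
  · rintro ⟨α₀, l⟩ -
    rw [map_smul, map_smul]
    by_cases hα₀ : b.tdeg α₀ = 1
    · have ht := 𝒜.map_mem _ _ (b.t_mem α₀)
      rw [hα₀] at ht
      rw [map_mul, ghostPart_mul_of_ghostFree _ _ (hw l),
        ghostPart_eq_zero_of_lt (by omega) ht, zero_mul, smul_zero]
    · rw [hc _ _ hα₀, zero_div, zero_smul]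
  · intro l _
    rw [map_smul, map_smul, ghostPart_zero_eq_self_iff.1 (hw l) _ (by omega), smul_zero]

/-- If the truncated BRST complex closes, then in the generators `t^α` and `φ(σ(t^α))` the element
`d_W φ(σ(t^α))` contains only monomials whose factors `t^β` have total degree at most `1`. Any
other monomial is detected by a connection on `ℝⁿ` whose value at the origin sends the `t^β` to
ghosts and the `φ(σ(t^β))` to forms. -/
theorem coeff_eq_zero_of_closes (hcl : b.TruncatedBRSTCloses φ) (α : ι) {K : ℕ}
    {c : Multiset (ι ⊕ ι) →₀ ℝ}
    (hc : c ∈ Finsupp.supported ℝ ℝ (FreeGC.monomials b.wdeg K))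
    (hP : b.adapted φ hφ hid (Finsupp.linearCombination ℝ (FreeGC.word b.wdeg) c)
      = b.dW (φ (b.st α)))
    {M : Multiset (ι ⊕ ι)} (hM : M ∈ FreeGC.monomials b.wdeg K)
    (hw : 2 ≤ (M.toList.map b.tWeight).sum) : c M = 0 := by
  let y : Fin M.toList.length → ι ⊕ ι := M.toList.get
  let d : Fin M.toList.length → ℕ := fun i => b.wdeg (y i)
  have hdpos : ∀ i, 0 < d i := fun i => b.wdeg_pos (y i)
  let Θ := Σ i : Fin M.toList.length, Fin (d i)
  let e : Θ ≃ Fin (Fintype.card Θ) := Fintype.equivFin Θ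
  let gh : Θ → ℕ := fun _ => 1
  -- The letter `t^β` of the monomial is represented by a product of ghosts of degree `1`, and
  -- `σ(t^β)` by a product of the forms `dxⁱ`.
  let θ : Θ → Fin (Fintype.card Θ) ⊕ Θ := fun s =>
    Sum.elim (fun _ => Sum.inr s) (fun _ => Sum.inl (e s)) (y s.1)
  have hθ : Function.Injective θ := by
    intro s s' h
    simp only [θ] at h
    rcases hs : y s.1 with β | β <;> rcases hs' : y s'.1 with β' | β' <;> simp [hs, hs'] at h
    · exact h
    · exact h
  let D := fieldDeg (Fintype.card Θ) gh
  have hD : ∀ x, D x = 1 := by rintro (i | g) <;> rfl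
  let v : Fin M.toList.length → FreeGC D := FreeGC.block D θ
  have hvm : ∀ i, v i ∈ FreeGC.homog D (d i) := FreeGC.block_mem hD
  have hv : ∀ i j, v i * v j
      = (-1 : ℝ) ^ (b.wdeg (y i) * b.wdeg (y j)) • (v j * v i) := fun i j =>
    FreeGC.graded_comm (hvm i) (hvm j)
  have hθw : ∀ i, ∑ j, ghostWeight (Fintype.card Θ) gh (θ ⟨i, j⟩) = b.tWeight (y i) := by
    intro i
    have : ∀ j, ghostWeight (Fintype.card Θ) gh (θ ⟨i, j⟩)
        = Sum.elim (fun _ => 1) (fun _ => 0) (y i) := by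
      intro j
      simp only [θ]
      rcases y i with β | β <;> rfl
    simp only [this, Finset.sum_const, Finset.card_univ, Fintype.card_fin, d]
    rcases y i with β | β <;> simp [wdeg, tWeight]
  let F : b.Weil →ₐ[ℝ] FreeGC D :=
    FreeGC.lift (FreeGC.letterSum y v) (FreeGC.letterSum_comm hv)
  have hFg : ∀ x, F (FreeGC.gen b.wdeg x) = FreeGC.letterSum y v x := FreeGC.lift_gen _ _
  obtain ⟨𝒜, h𝒜s, h𝒜e⟩ := b.exists_connection φ hφ hid (gh := gh) (fun _ => one_pos) F
    (fun x => by
      rw [hFg]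
      exact FreeGC.letterSum_mem _ fun i hi => hi ▸ hvm i)
    (fun β => by
      have h := hFg (Sum.inl β)
      rw [t, h]
      refine FreeGC.letterSum_mem (LinearMap.ker (FreeGC.weightPart D _ 0)) fun i hi => ?_
      rw [LinearMap.mem_ker, FreeGC.weightPart_block, if_neg]
      rw [hθw, hi]
      simp [tWeight, tdeg])
    (fun β => by
      have h := hFg (Sum.inr β)
      rw [st, h]
      refine FreeGC.letterSum_mem (LinearMap.eqLocus (FreeGC.weightPart D _ 0) LinearMap.id)
        fun i hi => ?_
      rw [LinearMap.mem_eqLocus, FreeGC.weightPart_block, if_pos]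
      · rfl
      · rw [hθw, hi]
        rfl)
  obtain ⟨N, hN, hFc⟩ := FreeGC.lift_letterSum_linearCombination hv b.wdeg_pos
    (FreeGC.block_sq hD hdpos) hc hM (List.ofFn_get _)
  have hcontr : ContractibleSpace
      (⊤ : TopologicalSpace.Opens (EuclideanSpace ℝ (Fin (Fintype.card Θ)))) :=
    (Homeomorph.Set.univ (EuclideanSpace ℝ (Fin (Fintype.card Θ)))).contractibleSpace
  have hclose := hcl _ ⊤ hcontr Θ gh (fun _ => one_pos) 𝒜
    (fun β => ghostPart_zero_eq_self_iff.1 (h𝒜s β)) α ((M.toList.map b.tWeight).sum - 1) (by omega)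
  have hq : (M.toList.map b.tWeight).sum - 1 + 1 = (M.toList.map b.tWeight).sum := by omega
  have hclose' : ghostPart ⊤ gh (M.toList.map b.tWeight).sum
      (dU ⊤ gh (𝒜.map (φ (b.st α))) - 𝒜.map (b.dW (φ (b.st α)))) = 0 := by
    rw [← hq]; exact hclose
  rw [map_sub, ghostPart_dU, ghostPart_zero_eq_self_iff.1 (h𝒜s α) _ (by omega), map_zero, zero_sub,
    neg_eq_zero] at hclose'
  have hev := congrArg (evalAt ⊤ gh ⟨0, trivial⟩) hclose'
  rw [evalAt_ghostPart, map_zero, ← hP, h𝒜e, hFc, map_smul] at hev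
  have hsum : (M.toList.map b.tWeight).sum
      = ∑ i, ∑ j, ghostWeight (Fintype.card Θ) gh (θ ⟨i, j⟩) := by
    simp only [hθw]
    conv_lhs => rw [← List.ofFn_get M.toList, List.map_ofFn, List.sum_ofFn]
    rfl
  rw [hsum, FreeGC.weightPart_prod_block, smul_eq_zero] at hev
  have hNR : (N : ℝ) ≠ 0 := by exact_mod_cast hN.ne'
  exact (mul_eq_zero.1 (hev.resolve_right (FreeGC.prod_block_ne_zero hD hθ))).resolve_right hNR

theorem exists_map_inr_of_tWeight_eq_zero {l : List (ι ⊕ ι)} (hl : (l.map b.tWeight).sum = 0) :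
    ∃ l' : List ι, l = l'.map Sum.inr := by
  induction l with
  | nil => exact ⟨[], rfl⟩
  | cons x l ih =>
    simp only [List.map_cons, List.sum_cons, Nat.add_eq_zero_iff] at hl
    obtain ⟨l', rfl⟩ := ih hl.2
    rcases x with α | α
    · simp [tWeight, tdeg] at hl
    · exact ⟨α :: l', rfl⟩

theorem adapted_word_inr (l : List ι) :
    b.adapted φ hφ hid ((l.map Sum.inr).map (FreeGC.gen b.wdeg)).prod = b.stWord φ l := by
  rw [map_list_prod, List.map_map, List.map_map, stWord]
  congr 1
  exact List.map_congr_left fun β _ => b.adapted_gen φ hφ hid (Sum.inr β)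

/-- Words of `tWeight` at most `1` are products of `φ(σ(t^β))`, up to a sign and up to a single
factor `t^α` of degree `1`. -/
theorem adapted_word_mem {l : List (ι ⊕ ι)} (hl : (l.map b.tWeight).sum ≤ 1) :
    b.adapted φ hφ hid (l.map (FreeGC.gen b.wdeg)).prod ∈
      Submodule.span ℝ (Set.range (b.stWord φ)) ⊔
        Submodule.span ℝ ((fun p : ι × List ι => b.t p.1 * b.stWord φ p.2) ''
          {p | b.tdeg p.1 = 1}) := by
  rcases Nat.eq_zero_or_pos (l.map b.tWeight).sum with h0 | h1
  · obtain ⟨l', rfl⟩ := b.exists_map_inr_of_tWeight_eq_zero h0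
    rw [adapted_word_inr]
    exact Submodule.mem_sup_left (Submodule.subset_span ⟨l', rfl⟩)
  · obtain ⟨x, hx, hxw⟩ : ∃ x ∈ l, b.tWeight x ≠ 0 := by
      by_contra! h
      refine h1.ne' (List.sum_eq_zero fun q hq => ?_)
      obtain ⟨x, hx, rfl⟩ := List.mem_map.1 hq
      exact h x hx
    obtain ⟨s, u, rfl⟩ := List.append_of_mem hx
    rcases x with α | α
    · have hα : b.tWeight (Sum.inl α) = b.tdeg α := rfl
      simp only [List.map_append, List.map_cons, List.sum_append, List.sum_cons] at hl
      have hsu : ((s ++ u).map b.tWeight).sum = 0 := by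
        simp only [List.map_append, List.sum_append]
        omega
      obtain ⟨l', hl'⟩ := b.exists_map_inr_of_tWeight_eq_zero hsu
      have hp : (s ++ Sum.inl α :: u).Perm (Sum.inl α :: l'.map Sum.inr) :=
        hl' ▸ List.perm_middle
      obtain ⟨k, hk⟩ := FreeGC.exists_sign_of_perm (FreeGC.gen_mul_gen b.wdeg) hp
      rw [hk, map_smul, List.map_cons, List.prod_cons, map_mul, adapted_word_inr]
      refine Submodule.smul_mem _ _ (Submodule.mem_sup_right (Submodule.subset_span
        ⟨(α, l'), ?_, ?_⟩))
      · show b.tdeg α = 1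
        omega
      · rw [adapted_gen]; rfl
    · exact absurd rfl hxw

include hφ hid in
theorem exists_expansion_of_closes (hcl : b.TruncatedBRSTCloses φ) (α : ι) :
    ∃ (m : List ι →₀ ℝ) (n : ι × List ι →₀ ℝ),
      (∀ α₀ l, b.tdeg α₀ ≠ 1 → n (α₀, l) = 0) ∧
      b.dW (φ (b.st α)) =
        (m.sum fun l c => (c / (l.length.factorial : ℝ)) • b.stWord φ l) +
        (n.sum fun p c => (c / (p.2.length.factorial : ℝ)) • (b.t p.1 * b.stWord φ p.2)) := by
  let Ψ := b.adapted φ hφ hid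
  have hQ : Ψ.symm (b.dW (φ (b.st α))) ∈ FreeGC.homog b.wdeg (b.tdeg α + 1 + 1) :=
    FreeGC.symm_mem Ψ (b.adapted_mem φ hφ hid) _ _ (b.dW_mem (hφ _ _ (b.st_mem α)))
  obtain ⟨c, hc, hcQ⟩ := (Finsupp.mem_span_image_iff_linearCombination ℝ).1
    (FreeGC.homog_le_span_word _ hQ)
  have hP : Ψ (Finsupp.linearCombination ℝ (FreeGC.word b.wdeg) c) = b.dW (φ (b.st α)) := by
    rw [hcQ, AlgEquiv.apply_symm_apply]
  have hmem : b.dW (φ (b.st α)) ∈ Submodule.span ℝ (Set.range (b.stWord φ)) ⊔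
      Submodule.span ℝ ((fun p : ι × List ι => b.t p.1 * b.stWord φ p.2) ''
        {p | b.tdeg p.1 = 1}) := by
    rw [← hP, Finsupp.linearCombination_apply, Finsupp.sum, map_sum]
    refine Submodule.sum_mem _ fun M hM => ?_
    rw [map_smul]
    refine Submodule.smul_mem _ _ (b.adapted_word_mem φ hφ hid ?_)
    by_contra hw
    exact Finsupp.mem_support_iff.1 hM (b.coeff_eq_zero_of_closes φ hφ hid hcl α hc hP
      ((Finsupp.mem_supported _ _).1 hc hM) (by omega))
  have hfac : ∀ k : ℕ, (k.factorial : ℝ) ≠ 0 := fun k => by exact_mod_cast k.factorial_ne_zero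
  -- The factorials are absorbed into the spanning families.
  have h1 : Submodule.span ℝ (Set.range (b.stWord φ)) ≤ Submodule.span ℝ (Set.range
      fun l : List ι => (l.length.factorial : ℝ)⁻¹ • b.stWord φ l) := by
    refine Submodule.span_le.2 ?_
    rintro _ ⟨l, rfl⟩
    have := Submodule.smul_mem _ (l.length.factorial : ℝ) (Submodule.subset_span (R := ℝ)
      (s := Set.range fun l : List ι => (l.length.factorial : ℝ)⁻¹ • b.stWord φ l) ⟨l, rfl⟩)
    rwa [smul_inv_smul₀ (hfac _)] at this
  have h2 : Submodule.span ℝ ((fun p : ι × List ι => b.t p.1 * b.stWord φ p.2) ''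
        {p | b.tdeg p.1 = 1}) ≤ Submodule.span ℝ ((fun p : ι × List ι =>
          (p.2.length.factorial : ℝ)⁻¹ • (b.t p.1 * b.stWord φ p.2)) '' {p | b.tdeg p.1 = 1}) := by
    refine Submodule.span_le.2 ?_
    rintro _ ⟨p, hp, rfl⟩
    have := Submodule.smul_mem _ (p.2.length.factorial : ℝ) (Submodule.subset_span (R := ℝ)
      (s := (fun p : ι × List ι => (p.2.length.factorial : ℝ)⁻¹ • (b.t p.1 * b.stWord φ p.2)) ''
        {p | b.tdeg p.1 = 1}) ⟨p, hp, rfl⟩)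
    rwa [smul_inv_smul₀ (hfac _)] at this
  obtain ⟨x, hx, z, hz, hxz⟩ := Submodule.mem_sup.1 hmem
  obtain ⟨m, hm⟩ := (Finsupp.mem_span_range_iff_exists_finsupp).1 (h1 hx)
  obtain ⟨n, hn, hnz⟩ := (Finsupp.mem_span_image_iff_linearCombination ℝ).1 (h2 hz)
  refine ⟨m, n, fun α₀ l hα₀ => ?_, ?_⟩
  · by_contra hne
    exact hα₀ ((Finsupp.mem_supported _ _).1 hn (Finsupp.mem_support_iff.2 hne))
  · rw [← hxz, ← hm, ← hnz, Finsupp.linearCombination_apply]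
    simp only [smul_smul, div_eq_mul_inv]

end HomogeneousBasis

end HigherGauge

end

theorem mainTheorem2 {V : Type*} [AddCommGroup V] [Module ℝ V]
    (L : HigherGauge.LInfinityAlgebra V) {ι : Type*} (b : HigherGauge.HomogeneousBasis L ι)
    (φ : b.Weil ≃ₐ[ℝ] b.Weil) (hφ : b.IsGradedAut φ) (hid : b.CoversId φ) :
    b.IsAdjustment φ ↔
      ∀ α : ι, ∃ (m : List ι →₀ ℝ) (n : ι × List ι →₀ ℝ),
        (∀ α₀ l, b.tdeg α₀ ≠ 1 → n (α₀, l) = 0) ∧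
        b.dW (φ (b.st α)) =
          (m.sum fun l c => (c / (l.length.factorial : ℝ)) •
            (l.map fun β => φ (b.st β)).prod) +
          (n.sum fun p c => (c / (p.2.length.factorial : ℝ)) •
            (b.t p.1 * (p.2.map fun β => φ (b.st β)).prod)) :=
  ⟨fun h α => b.exists_expansion_of_closes φ hφ hid h.2.2 α,
    fun h => ⟨hφ, hid, b.truncatedBRSTCloses_of_expansion φ h⟩⟩
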